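/- A hypergraph is a finite set of vertices together with a set of subsets of it, called edges; a $3$-graph is a hypergraph all of whose edges have size $3$. For $l\ge 3$, let $C_l^3$ denote the $3$-uniform loose cycle of length $l$: it has $l$ edges $e_1,\dots,e_l$ of size $3$, indexed cyclically, such that consecutive edges meet in exactly one vertex, distinct non-consecutive edges are disjoint, and no vertex lies in three of the edges (the last condition matters only for $l=3$). Let $K_n^3$ be the hypergraph on $n$ vertices whose edges are all the $3$-element sets of vertices. Let $R(C_l^3,K_n^3)$ be the least integer $N$ such that every colouring of the edges of $K_N^3$ red and blue contains a copy of $C_l^3$ all of whose edges are red or a copy of $K_n^3$ all of whose edges are blue. Theorem. For every fixed $l\ge 3$ there is a constant $c_{3,l}$ such that for all $n$ the number $R(C_l^3,K_n^3)$ exists and $$R(C_l^3,K_n^3)\le c_{3,l}\, n^{1+1/\lfloor (l+1)/2\rfloor}.$$ In particular, there is a constant $c_{3,5}$ with $R(C_5^3,K_n^3)\le c_{3,5}\,n^{4/3}$ for all $n$. Equivalently, for every fixed $l\ge 3$, with $m=\lfloor (l-1)/2\rfloor$, there is a constant $c>0$ such that every $3$-graph on $n$ vertices that contains no copy of $C_l^3$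 has a set of at least $c\,n^{(m+1)/(m+2)}$ vertices that contains no edge. -/

import Mathlib

namespace Hypergraph

variable {α : Type*}

/-- `H` is `r`-uniform: every edge has exactly `r` vertices. -/
def IsUniform (H : Hypergraph α) (r : ℕ) : Prop :=
  ∀ e ∈ H.edgeSet, e.encard = r

/-- The cyclic sequence `e` of `l` edges (`l ≥ 3`) forms a loose cycle: consecutive edges
meet in exactly one vertex, distinct non-consecutive edges are disjoint, and no vertex lies in
three of the edges. The last condition follows from the others if `l ≥ 4`; for `l = 3` it says
that three edges through one common vertex are not a loose cycle. -/
structure IsLooseCycle (l : ℕ) (e : ZMod l → Set α) : Prop where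
  encard_inter_succ : ∀ i, (e i ∩ e (i + 1)).encard = 1
  disjoint : ∀ i j, i ≠ j → j ≠ i + 1 → i ≠ j + 1 → Disjoint (e i) (e j)
  inter_inter_eq_empty : ∀ i j k, i ≠ j → j ≠ k → i ≠ k → e i ∩ e j ∩ e k = ∅

/-- `H` contains a copy of the `r`-uniform loose cycle of length `l`. -/
def ContainsLooseCycle (H : Hypergraph α) (l r : ℕ) : Prop :=
  ∃ e : ZMod l → Set α, IsLooseCycle l e ∧ ∀ i, e i ∈ H.edgeSet ∧ (e i).encard = r

/-- `H` contains a copy of the `r`-uniform clique of order `n`. -/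
def ContainsClique (H : Hypergraph α) (n r : ℕ) : Prop :=
  ∃ s ⊆ H.vertexSet, s.encard = n ∧ ∀ e ⊆ s, e.encard = r → e ∈ H.edgeSet

/-- The set `s` of vertices of `H` is independent: it contains no edge of `H`. -/
def IsIndependent (H : Hypergraph α) (s : Set α) : Prop :=
  s ⊆ H.vertexSet ∧ ∀ e ∈ H.edgeSet, ¬ e ⊆ s

/-- The `r`-uniform clique on the vertices `0, …, N - 1`. -/
def uniformClique (N r : ℕ) : Hypergraph (Fin N) where
  vertexSet := Set.univ
  edgeSet := {e | e.encard = r}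
  subset_vertexSet_of_mem_edgeSet' := fun e _ => Set.subset_univ e

/-- For a colouring `c` of the edges of `K` with two colours, the hypergraph on the vertices of `K`
that consists of the edges of colour `b`. -/
def colourClass (K : Hypergraph α) (c : K.edgeSet → Bool) (b : Bool) : Hypergraph α where
  vertexSet := K.vertexSet
  edgeSet := {e | ∃ h : e ∈ K.edgeSet, c ⟨e, h⟩ = b}
  subset_vertexSet_of_mem_edgeSet' := fun _ he => K.subset_vertexSet_of_mem_edgeSet' he.1

/-- Every colouring of the edges of the `r`-uniform clique of order `N` with the colours red
(`true`) and blue (`false`) has a red `r`-uniform loose cycle of length `l` or a blue `r`-uniform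
clique of order `n`. -/
def RamseyProperty (l n r N : ℕ) : Prop :=
  ∀ c : (uniformClique N r).edgeSet → Bool,
    ((uniformClique N r).colourClass c true).ContainsLooseCycle l r ∨
      ((uniformClique N r).colourClass c false).ContainsClique n r

/-- `R` is the Ramsey number of the `r`-uniform loose cycle of length `l` versus the `r`-uniform
clique of order `n`: the least `N` with the Ramsey property. -/
def IsRamseyNumber (l n r R : ℕ) : Prop :=
  IsLeast {N : ℕ | RamseyProperty l n r N} R

end Hypergraph

/-! ### Loose walks in families of triples -/

namespace TripleSystem

variable {α : Type*}

/-! Put `D ≈ n^(1/(m+2))`. The target is an independent set of order `n / D`, which is also the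
order of `D^(m+1)`. Either it exists for a cheap reason, or the triples are rich enough to grow a
search forest of depth `m` whose last level has order `D^(m+1)` and contains an independent set of
constant proportion.

The cheap reasons are failure of expansion (`exists_indep_or_expands`) and sparsity
(`exists_indep_of_card_le`, a random colouring). Otherwise some `U` with at least half of the
vertices expands and spans more than `D^2 |U| / 2` triples. Charging every triple to one of its
pairs (`exists_charging`) then gives a vertex that starts a first level of order `D^2`
(`exists_level_one`). If a subset `X` of a level is independent and its pairs form triples with only
`O(|X|)` new vertices, expansion yields a next level of order `D |X|` (`exists_disjoint_family`,
`Level.succ`).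

Such an `X` of constant proportion comes from the absence of loose `l`-cycles
(`Level.exists_sparse_subset`). Fix a depth `j < i` and group the vertices of level `i` by their
ancestor at depth `j` (class) and at depth `j + 1` (branch). If all sparse subsets were small,
repeated greedy removal would leave a vertex that starts a loose walk of length `l - 2(i - j)`
inside its class, ending in a strictly earlier branch (`exists_descending_walks`). The forest joins
the two ends by a loose path of length exactly `2(i - j)`, which closes a loose `l`-cycle. The walk
length is free, so the parity of `l` is irrelevant; only `2i < l` is needed, hence depth up to `m`.
Applying this for `j = i - 1, …, 0` merges the classes into the whole level (`Level.exists_indep`).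
-/

/-- The vertices of a walk, without its starting point. -/
def verts (P : List (α × α)) : List α := P.flatMap fun p => [p.1, p.2]

@[simp] theorem verts_nil : verts ([] : List (α × α)) = [] := rfl

@[simp] theorem verts_cons (p : α × α) (P : List (α × α)) :
    verts (p :: P) = p.1 :: p.2 :: verts P := rfl

@[simp] theorem verts_append (P Q : List (α × α)) : verts (P ++ Q) = verts P ++ verts Q := by
  simp [verts]

theorem length_verts (P : List (α × α)) : (verts P).length = 2 * P.length := by
  induction P with
  | nil => rfl
  | cons p P ih => simp [ih]; ring

theorem fst_mem_verts {P : List (α × α)} {p : α × α} (h : p ∈ P) : p.1 ∈ verts P :=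
  List.mem_flatMap.2 ⟨p, h, by simp⟩

theorem snd_mem_verts {P : List (α × α)} {p : α × α} (h : p ∈ P) : p.2 ∈ verts P :=
  List.mem_flatMap.2 ⟨p, h, by simp⟩

theorem nodup_fst_of_verts {P : List (α × α)} (h : (verts P).Nodup) :
    (P.map Prod.fst).Nodup ∧ (P.map Prod.snd).Nodup ∧
      ∀ p ∈ P, ∀ p' ∈ P, p.1 ≠ p'.2 := by
  induction P with
  | nil => simp
  | cons p P ih =>
    simp only [verts_cons, List.nodup_cons, List.mem_cons, not_or] at h
    obtain ⟨⟨h1, h2⟩, h3, h4⟩ := h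
    obtain ⟨i1, i2, i3⟩ := ih h4
    refine ⟨?_, ?_, ?_⟩
    · rw [List.map_cons, List.nodup_cons]
      refine ⟨?_, i1⟩
      intro hm
      obtain ⟨x, hx, hxe⟩ := List.mem_map.1 hm
      exact h2 (hxe ▸ fst_mem_verts hx)
    · rw [List.map_cons, List.nodup_cons]
      refine ⟨?_, i2⟩
      intro hm
      obtain ⟨x, hx, hxe⟩ := List.mem_map.1 hm
      exact h3 (hxe ▸ snd_mem_verts hx)
    · intro x hx y hy hxy
      rcases List.mem_cons.1 hx with hx' | hx' <;> rcases List.mem_cons.1 hy with hy' | hy'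
      · rw [hx', hy'] at hxy; exact h1 hxy
      · exact h2 (hx' ▸ hxy ▸ snd_mem_verts hy')
      · exact h3 (hy' ▸ hxy ▸ fst_mem_verts hx')
      · exact i3 x hx' y hy' hxy

theorem isLooseCycle_of_injective {l : ℕ} (hl : 3 ≤ l) {s w : ZMod l → α}
    (hs : Function.Injective s) (hw : Function.Injective w) (hsw : ∀ i j, s i ≠ w j) :
    Hypergraph.IsLooseCycle l fun i => ({s i, w i, s (i + 1)} : Set α) := by
  have h1 : (1 : ZMod l) ≠ 0 := by
    have : Fact (1 < l) := ⟨by omega⟩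
    exact one_ne_zero
  have h2 : (1 : ZMod l) + 1 ≠ 0 := by
    intro h
    have : ((2 : ℕ) : ZMod l) = 0 := by push_cast; rw [← h]; norm_num
    rw [ZMod.natCast_eq_zero_iff] at this
    exact absurd (Nat.le_of_dvd (by norm_num) this) (by omega)
  refine ⟨?_, ?_, ?_⟩
  · intro i
    have : ({s i, w i, s (i + 1)} ∩ {s (i + 1), w (i + 1), s (i + 1 + 1)} : Set α)
        = {s (i + 1)} := by
      ext x
      simp only [Set.mem_inter_iff, Set.mem_insert_iff, Set.mem_singleton_iff]
      constructor
      · rintro ⟨h | h | h, h' | h' | h'⟩ <;> try assumption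
        · exact absurd (h.symm.trans h') (hsw _ _)
        · have := hs (h.symm.trans h')
          rw [add_assoc] at this
          exact absurd (left_eq_add.1 this) h2
        · have := hw (h.symm.trans h')
          exact absurd (left_eq_add.1 this) h1
        · exact absurd (h'.symm.trans h) (hsw _ _)
      · rintro rfl
        exact ⟨Or.inr (Or.inr rfl), Or.inl rfl⟩
    rw [this, Set.encard_singleton]
  · intro i j hij hj hi
    rw [Set.disjoint_left]
    intro x hx hx'
    simp only [Set.mem_insert_iff, Set.mem_singleton_iff] at hx hx'
    rcases hx with h | h | h <;> rcases hx' with h' | h' | h'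
    · exact hij (hs (h.symm.trans h'))
    · exact hsw _ _ (h.symm.trans h')
    · exact hi (hs (h.symm.trans h'))
    · exact hsw _ _ (h'.symm.trans h)
    · exact hij (hw (h.symm.trans h'))
    · exact hsw _ _ (h'.symm.trans h)
    · exact hj (hs (h'.symm.trans h))
    · exact hsw _ _ (h.symm.trans h')
    · exact hij (add_right_cancel (hs (h.symm.trans h')))
  · intro i j k hij hjk hik
    rw [Set.eq_empty_iff_forall_notMem]
    rintro x ⟨⟨hx, hx'⟩, hx''⟩
    simp only [Set.mem_insert_iff, Set.mem_singleton_iff] at hx hx' hx''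
    -- A vertex in two distinct edges is a joint `s a`, where `a` is the later of the two
    -- consecutive indices; a third edge through it would coincide with one of them.
    have key : ∀ a b : ZMod l, a ≠ b → (x = s a ∨ x = w a ∨ x = s (a + 1)) →
        (x = s b ∨ x = w b ∨ x = s (b + 1)) →
        (x = s a ∧ a = b + 1) ∨ (x = s b ∧ b = a + 1) := by
      intro a b hab ha hb
      rcases ha with h | h | h <;> rcases hb with h' | h' | h'
      · exact absurd (hs (h.symm.trans h')) hab
      · exact absurd (h.symm.trans h') (hsw _ _)
      · exact Or.inl ⟨h, hs (h.symm.trans h')⟩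
      · exact absurd (h'.symm.trans h) (hsw _ _)
      · exact absurd (hw (h.symm.trans h')) hab
      · exact absurd (h'.symm.trans h) (hsw _ _)
      · exact Or.inr ⟨h', hs (h'.symm.trans h)⟩
      · exact absurd (h.symm.trans h') (hsw _ _)
      · exact absurd (add_right_cancel (hs (h.symm.trans h'))) hab
    rcases key i j hij hx hx' with ⟨a1, a2⟩ | ⟨a1, a2⟩ <;>
    rcases key j k hjk hx' hx'' with ⟨b1, b2⟩ | ⟨b1, b2⟩ <;>
    rcases key i k hik hx hx'' with ⟨c1, c2⟩ | ⟨c1, c2⟩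
    all_goals first
      | exact hij (hs (a1.symm.trans b1))
      | exact hjk (hs (a1.symm.trans b1))
      | exact hjk (hs (a1.symm.trans c1))
      | exact hjk (hs (b1.symm.trans c1))
      | exact hjk (add_right_cancel (a2.symm.trans c2))
      | exact hik (hs (a1.symm.trans b1))
      | exact hij (hs (c1.symm.trans b1))

variable [DecidableEq α]

/-- `Walk E a P b`: the list `P = [(w₁, c₁), …, (wₖ, cₖ)]` describes a walk
`a, c₁, …, cₖ = b` whose steps are the triples `{cᵢ₋₁, wᵢ, cᵢ}` of `E`. -/
def Walk (E : Finset (Finset α)) : α → List (α × α) → α → Prop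
  | a, [], b => a = b
  | a, (w, c) :: P, b => ({a, w, c} : Finset α) ∈ E ∧ Walk E c P b

theorem Walk.append {E : Finset (Finset α)} {a b c : α} {P Q : List (α × α)}
    (hP : Walk E a P b) (hQ : Walk E b Q c) : Walk E a (P ++ Q) c := by
  induction P generalizing a with
  | nil => cases hP; exact hQ
  | cons p P ih => exact ⟨hP.1, ih hP.2⟩

theorem Walk.mono {E E' : Finset (Finset α)} (h : E ⊆ E') {a b : α} {P : List (α × α)}
    (hP : Walk E a P b) : Walk E' a P b := by
  induction P generalizing a with
  | nil => exact hP
  | cons p P ih => exact ⟨h hP.1, ih hP.2⟩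

theorem Walk.end_mem {E : Finset (Finset α)} {a b : α} {P : List (α × α)}
    (hP : Walk E a P b) (h : P ≠ []) : b ∈ verts P := by
  induction P generalizing a with
  | nil => exact absurd rfl h
  | cons p P ih =>
    rcases P with _ | ⟨p', P⟩
    · have : p.2 = b := hP.2
      simp [this]
    · have := ih hP.2 (by simp)
      rw [verts_cons]
      simp only [List.mem_cons]
      exact Or.inr (Or.inr this)

/-- The family `E` has no loose cycle of length `l`. -/
def CycleFree (E : Finset (Finset α)) (l : ℕ) : Prop :=
  ∀ a P, Walk E a P a → P.length = l → ¬ (verts P).Nodup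

theorem CycleFree.subset {E E' : Finset (Finset α)} {l : ℕ} (h : CycleFree E' l) (hs : E ⊆ E') :
    CycleFree E l := fun a P hP => h a P (hP.mono hs)

theorem Walk.getElem_mem {E : Finset (Finset α)} {a b : α} {P : List (α × α)}
    (hP : Walk E a P b) (k : ℕ) (hk : k < P.length) :
    ({(a :: P.map Prod.snd)[k]'(by simp; omega), P[k].1, P[k].2} : Finset α) ∈ E := by
  induction P generalizing a k with
  | nil => simp at hk
  | cons p P ih =>
    rcases k with _ | k
    · exact hP.1
    · exact ih hP.2 k (by simpa using hk)

theorem Walk.getLast {E : Finset (Finset α)} {a b : α} {P : List (α × α)}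
    (hP : Walk E a P b) : (a :: P.map Prod.snd)[P.length]'(by simp) = b := by
  induction P generalizing a with
  | nil => exact hP
  | cons p P ih => exact ih hP.2

theorem exists_isLooseCycle_of_walk {E : Finset (Finset α)} {l : ℕ} (hl : 3 ≤ l) {a : α}
    {P : List (α × α)} (hP : Walk E a P a) (hlen : P.length = l) (hnd : (verts P).Nodup) :
    ∃ e : ZMod l → Set α, Hypergraph.IsLooseCycle l e ∧
      ∀ i, ∃ t ∈ E, e i = (t : Set α) := by
  have : NeZero l := ⟨by omega⟩
  have : Fact (1 < l) := ⟨by omega⟩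
  obtain ⟨n1, n2, n3⟩ := nodup_fst_of_verts hnd
  have hv : ∀ i : ZMod l, i.val < P.length := fun i => hlen ▸ i.val_lt
  let s : ZMod l → α := fun i => (P[i.val]'(hv i)).2
  -- The shift by one is forced: the triple that leaves the connector `s i` is the next entry of the
  -- walk.
  let w : ZMod l → α := fun i => (P[(i + 1).val]'(hv _)).1
  have hs : Function.Injective s := by
    intro i j hij
    have h := (List.Nodup.getElem_inj_iff n2 (i := i.val) (j := j.val)
      (hi := by simpa using hv i) (hj := by simpa using hv j)).1 (by simpa [s] using hij)
    exact ZMod.val_injective l h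
  have hw : Function.Injective w := by
    intro i j hij
    have h := (List.Nodup.getElem_inj_iff n1 (i := (i + 1).val) (j := (j + 1).val)
      (hi := by simpa using hv _) (hj := by simpa using hv _)).1 (by simpa [w] using hij)
    exact add_right_cancel (ZMod.val_injective l h)
  have hsw : ∀ i j, s i ≠ w j := fun i j h =>
    n3 _ (List.getElem_mem (hv (j + 1))) _ (List.getElem_mem (hv i)) h.symm
  refine ⟨_, isLooseCycle_of_injective hl hs hw hsw, fun i => ⟨{s i, w i, s (i + 1)}, ?_, by simp⟩⟩
  have h := hP.getElem_mem (i + 1).val (hv _)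
  have hval : (i + 1).val = (i.val + 1) % l := by
    rw [ZMod.val_add, ZMod.val_one]
  have : (a :: P.map Prod.snd)[(i + 1).val]'(by simp; have := hv (i + 1); omega) = s i := by
    by_cases hi : i.val + 1 < l
    · have h' : (i + 1).val = i.val + 1 := by rw [hval, Nat.mod_eq_of_lt hi]
      simp [h', s]
    -- At the wrap-around the triple starts at `a`, which is the last connector because the walk is
    -- closed.
    · have hi' : i.val + 1 = l := by have := i.val_lt; omega
      have h' : (i + 1).val = 0 := by rw [hval, hi', Nat.mod_self]
      have hg := hP.getLast
      have hk : P.length = i.val + 1 := by omega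
      simp only [h', List.getElem_cons_zero]
      simp only [hk, List.getElem_cons_succ, List.getElem_map] at hg
      exact hg.symm
  rw [this] at h
  exact h

end TripleSystem

namespace TripleSystem

variable {α : Type*} [DecidableEq α]

/-! ### Codegrees and peeling -/

theorem ne_of_mem {E : Finset (Finset α)} (hE : ∀ e ∈ E, e.card = 3) {a b c : α}
    (h : ({a, b, c} : Finset α) ∈ E) : a ≠ b ∧ a ≠ c ∧ b ≠ c := by
  have := hE _ h
  refine ⟨?_, ?_, ?_⟩ <;> rintro rfl
  · rw [Finset.insert_eq_of_mem (by simp)] at this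
    exact absurd this (by have := Finset.card_le_two (a := a) (b := c); omega)
  · rw [Finset.insert_eq_of_mem (by simp)] at this
    exact absurd this (by have := Finset.card_le_two (a := b) (b := a); omega)
  · rw [Finset.pair_eq_singleton] at this
    exact absurd this (by have := Finset.card_le_two (a := a) (b := b); omega)

theorem swap_left {E : Finset (Finset α)} {a b c : α} (h : ({a, b, c} : Finset α) ∈ E) :
    ({b, a, c} : Finset α) ∈ E := by
  rwa [Finset.insert_comm]

theorem swap_right {E : Finset (Finset α)} {a b c : α} (h : ({a, b, c} : Finset α) ∈ E) :
    ({a, c, b} : Finset α) ∈ E := by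
  rwa [Finset.pair_comm]

theorem eq_triple_of_pair_subset {e : Finset α} (he : e.card = 3) {a b : α} (hab : a ≠ b)
    (h : {a, b} ⊆ e) : ∃ c, e = {a, b, c} := by
  have h1 : (e \ {a, b}).card = 1 := by
    rw [Finset.card_sdiff_of_subset h, he, Finset.card_pair hab]
  obtain ⟨c, hc⟩ := Finset.card_eq_one.1 h1
  refine ⟨c, ?_⟩
  rw [← Finset.union_sdiff_of_subset h, hc]
  ext x; simp

/-- The number of triples of `E` that contain `q`. -/
def codegree (E : Finset (Finset α)) (q : Finset α) : ℕ := (E.filter fun e => q ⊆ e).card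

theorem exists_third {E : Finset (Finset α)} (hE : ∀ e ∈ E, e.card = 3) {a b : α} (hab : a ≠ b)
    {S : Finset α} (hS : S.card < codegree E {a, b}) : ∃ w ∉ S, ({a, b, w} : Finset α) ∈ E := by
  by_contra! hcon
  refine absurd hS (not_lt.2 ?_)
  refine (Finset.card_le_card ?_).trans (Finset.card_image_le (s := S) (f := fun w => {a, b, w}))
  intro e he
  rw [Finset.mem_filter] at he
  obtain ⟨c, rfl⟩ := eq_triple_of_pair_subset (hE e he.1) hab he.2
  refine Finset.mem_image.2 ⟨c, ?_, rfl⟩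
  by_contra hc
  exact hcon c hc he.1

/-- The current vertex and the target `b` always lie in a common triple. Moving to the third vertex
`t` of such a triple preserves this, and the step itself uses another triple through `{a, t}`, so
that `b` stays unused. Each step forbids two more vertices, whence the `2 * k`. -/
theorem exists_walk_of_full {E : Finset (Finset α)} (hE : ∀ e ∈ E, e.card = 3) {N : ℕ}
    (hfull : ∀ a b c, ({a, b, c} : Finset α) ∈ E → N < codegree E {a, b}) (k : ℕ) :
    ∀ (a b c : α) (S : Finset α), ({a, b, c} : Finset α) ∈ E → b ∉ S → S.card + 2 * k ≤ N →
      ∃ P, P.length = k + 1 ∧ Walk E a P b ∧ (a :: verts P).Nodup ∧ ∀ z ∈ verts P, z ∉ S := by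
  induction k with
  | zero =>
    intro a b c S habc hb hS
    have hab := (ne_of_mem hE habc).1
    obtain ⟨w, hw, hwE⟩ := exists_third hE hab (S := S) (by have := hfull a b c habc; omega)
    obtain ⟨-, h2, h3⟩ := ne_of_mem hE hwE
    exact ⟨[(w, b)], rfl, ⟨swap_right hwE, rfl⟩, by simp [hab, h2, h3.symm], by simp [hw, hb]⟩
  | succ k ih =>
    intro a b c S habc hb hS
    have hab := (ne_of_mem hE habc).1
    obtain ⟨t, ht, htE⟩ := exists_third hE hab (S := S) (by have := hfull a b c habc; omega)
    obtain ⟨-, hat, hbt⟩ := ne_of_mem hE htE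
    obtain ⟨w, hw, hwE⟩ := exists_third hE hat (S := insert b S) (by
      have := hfull a t b (swap_right htE)
      have := Finset.card_insert_le b S
      omega)
    obtain ⟨-, haw, htw⟩ := ne_of_mem hE hwE
    rw [Finset.mem_insert, not_or] at hw
    have htba : ({t, b, a} : Finset α) ∈ E := swap_right (swap_left (swap_right htE))
    obtain ⟨P, hlen, hP, hnd, hav⟩ := ih t b a (insert a (insert w S)) htba
      (by simp [hab.symm, Ne.symm hw.1, hb]) (by
        have := Finset.card_insert_le a (insert w S)
        have := Finset.card_insert_le w S
        omega)
    refine ⟨(w, t) :: P, by simp [hlen], ⟨swap_right hwE, hP⟩, ?_, ?_⟩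
    · have ha : a ∉ verts P := fun h => hav a h (by simp)
      have hw' : w ∉ verts P := fun h => hav w h (by simp)
      rw [List.nodup_cons] at hnd
      simp [haw, hat, ha, htw.symm, hw', hnd.1, hnd.2]
    · intro z hz
      rw [verts_cons] at hz
      rcases List.mem_cons.1 hz with rfl | hz
      · exact hw.2
      rcases List.mem_cons.1 hz with rfl | hz
      · exact ht
      · have := hav z hz
        simp only [Finset.mem_insert, not_or] at this
        exact this.2.2

theorem exists_codegree_le {E : Finset (Finset α)} (hE : ∀ e ∈ E, e.card = 3) {l : ℕ} (hl : 3 ≤ l)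
    (hfree : CycleFree E l) (hne : E.Nonempty) :
    ∃ a b c, ({a, b, c} : Finset α) ∈ E ∧ codegree E {a, b} ≤ 2 * l := by
  by_contra! hcon
  obtain ⟨e, he⟩ := hne
  obtain ⟨a, b, c, -, -, -, rfl⟩ := Finset.card_eq_three.1 (hE e he)
  obtain ⟨hab, hac, hbc⟩ := ne_of_mem hE he
  -- A walk of length `l - 1` from `a` to `b` that avoids `c` is closed by the triple `{b, c, a}`;
  -- its budget is `1 + 2(l - 2) ≤ 2l`.
  obtain ⟨P, hlen, hP, hnd, hav⟩ := exists_walk_of_full hE hcon (l - 2) a b c {c} he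
    (by simpa using hbc) (by simp; omega)
  rw [List.nodup_cons] at hnd
  refine hfree a (P ++ [(c, a)]) (hP.append ⟨swap_right (swap_left he), rfl⟩) (by simp [hlen]; omega) ?_
  rw [verts_append, List.nodup_append]
  refine ⟨hnd.2, by simp [hac.symm], ?_⟩
  intro x hx y hy hxy
  subst hxy
  simp only [verts_cons, verts_nil, List.mem_cons, List.not_mem_nil, or_false] at hy
  rcases hy with rfl | rfl
  · exact hav _ hx (by simp)
  · exact hnd.1 hx

/-- In a family without loose cycles of length `l`, every triple can be charged to one of its
pairs so that every pair is charged a bounded number of times. -/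
theorem exists_charging {l : ℕ} (hl : 3 ≤ l) (E : Finset (Finset α)) (hE : ∀ e ∈ E, e.card = 3)
    (hfree : CycleFree E l) :
    ∃ p : Finset α → Finset α, (∀ e ∈ E, p e ⊆ e ∧ (p e).card = 2) ∧
      ∀ q, (E.filter fun e => p e = q).card ≤ 2 * l := by
  induction E using Finset.strongInduction with
  | H E ih =>
  rcases E.eq_empty_or_nonempty with rfl | hne
  · exact ⟨id, by simp, by simp⟩
  obtain ⟨a, b, c, habc, hdeg⟩ := exists_codegree_le hE hl hfree hne
  have hab := (ne_of_mem hE habc).1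
  obtain ⟨F, hF⟩ : ∃ F, F = E.filter fun e => ¬ ({a, b} : Finset α) ⊆ e := ⟨_, rfl⟩
  have hmem : ∀ e, e ∈ F ↔ e ∈ E ∧ ¬ ({a, b} : Finset α) ⊆ e := by
    intro e; rw [hF, Finset.mem_filter]
  have hsub : F ⊆ E := fun e he => ((hmem e).1 he).1
  have hss : F ⊂ E := by
    refine Finset.ssubset_iff_subset_ne.2 ⟨hsub, fun h => ?_⟩
    rw [← h] at habc
    refine ((hmem _).1 habc).2 fun x hx => ?_
    simp only [Finset.mem_insert, Finset.mem_singleton] at hx ⊢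
    tauto
  obtain ⟨p, hp, hpq⟩ := ih F hss (fun e he => hE e (hsub he)) (hfree.subset hsub)
  -- The pair of low codegree takes all triples through it. It gets no other charge, since the
  -- triples of `F` do not contain it.
  refine ⟨fun e => if {a, b} ⊆ e then {a, b} else p e, ?_, ?_⟩
  · intro e he
    by_cases h : {a, b} ⊆ e
    · simp only [if_pos h]
      exact ⟨h, Finset.card_pair hab⟩
    · simp only [if_neg h]
      exact hp e ((hmem e).2 ⟨he, h⟩)
  · intro q
    by_cases hq : q = {a, b}
    · refine (Finset.card_le_card ?_).trans hdeg
      intro e he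
      rw [Finset.mem_filter] at he ⊢
      refine ⟨he.1, ?_⟩
      by_contra h
      have h2 := he.2
      simp only [if_neg h, hq] at h2
      exact h (h2 ▸ (hp e ((hmem e).2 ⟨he.1, h⟩)).1)
    · refine (Finset.card_le_card ?_).trans (hpq q)
      intro e he
      rw [Finset.mem_filter] at he ⊢
      have h2 := he.2
      by_cases h : {a, b} ⊆ e
      · simp only [if_pos h] at h2
        exact absurd h2.symm hq
      · simp only [if_neg h] at h2
        exact ⟨(hmem e).2 ⟨he.1, h⟩, h2⟩

/-! ### Independent sets in sparse families of triples -/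

/-- No triple of `E` is contained in `S`. -/
def Indep (E : Finset (Finset α)) (S : Finset α) : Prop := ∀ e ∈ E, ¬ e ⊆ S

/-- A colouring constant on `{x, y, z}` can be recovered after `y` and `z` are recoloured
arbitrarily: the colour of `x` restores them. This injects `t ^ 2` copies of the set into all
colourings. -/
theorem card_monochromatic_mul_le {ι : Type*} [Fintype ι] [DecidableEq ι] {t : ℕ} {x y z : ι}
    (hxy : x ≠ y) (hxz : x ≠ z) (hyz : y ≠ z) :
    (Finset.univ.filter fun f : ι → Fin t => f y = f x ∧ f z = f x).card * t ^ 2 ≤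
      Fintype.card (ι → Fin t) := by
  have h : ((Finset.univ.filter fun f : ι → Fin t => f y = f x ∧ f z = f x) ×ˢ
      (Finset.univ : Finset (Fin t × Fin t))).card ≤ (Finset.univ : Finset (ι → Fin t)).card := by
    refine Finset.card_le_card_of_injOn
      (fun q => Function.update (Function.update q.1 y q.2.1) z q.2.2) (by simp) ?_
    rintro ⟨f, c, d⟩ hf ⟨f', c', d'⟩ hf' heq
    simp only [Finset.coe_product, Finset.coe_filter, Finset.coe_univ, Set.mem_prod,
      Set.mem_ofPred_eq, Finset.mem_univ, true_and, Set.mem_univ, and_true] at hf hf'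
    have hv : ∀ u, Function.update (Function.update f y c) z d u =
        Function.update (Function.update f' y c') z d' u := fun u => congrFun heq u
    have hd : d = d' := by simpa using hv z
    have hc : c = c' := by simpa [hyz] using hv y
    have hx : f x = f' x := by simpa [hxy, hxz] using hv x
    have hff : f = f' := by
      funext u
      by_cases huy : u = y
      · rw [huy, hf.1, hf'.1, hx]
      by_cases huz : u = z
      · rw [huz, hf.2, hf'.2, hx]
      simpa [huy, huz] using hv u
    rw [hff, hc, hd]
  rw [Finset.card_product, Finset.card_univ, Finset.card_univ, Fintype.card_prod,
    Fintype.card_fin, ← sq] at h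
  exact h

/-- In a random `t`-colouring the expected number of monochromatic triples is at most `|E| / t ^ 2 ≤
|U| / 2`. Some colour class therefore exceeds its number of triples by `|U| / (2t)`, and one vertex
is deleted from each of these triples. -/
theorem exists_indep_of_card_le {U : Finset α} {E : Finset (Finset α)}
    (hE : ∀ e ∈ E, e.card = 3) (hEU : ∀ e ∈ E, e ⊆ U) {t : ℕ} (ht : 0 < t)
    (h : 2 * E.card ≤ t ^ 2 * U.card) :
    ∃ S ⊆ U, Indep E S ∧ U.card ≤ 2 * t * S.card := by
  classical
  rcases E.eq_empty_or_nonempty with rfl | ⟨e₀, he₀⟩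
  · exact ⟨U, subset_rfl, by simp [Indep], by nlinarith⟩
  have : Nonempty α :=
    ⟨(Finset.card_pos.1 (by rw [hE e₀ he₀]; norm_num : 0 < e₀.card)).choose⟩
  let mono : (U → Fin t) → Finset α → Fin t → Prop := fun f e c => ∀ u : U, (u : α) ∈ e → f u = c
  have hbound : ∀ e ∈ E, (Finset.univ.filter fun f : U → Fin t => ∃ c, mono f e c).card * t ^ 2 ≤
      Fintype.card (U → Fin t) := by
    intro e he
    obtain ⟨x, y, z, hxy, hxz, hyz, rfl⟩ := Finset.card_eq_three.1 (hE e he)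
    have hx : x ∈ U := hEU _ he (by simp)
    have hy : y ∈ U := hEU _ he (by simp)
    have hz : z ∈ U := hEU _ he (by simp)
    refine le_trans (Nat.mul_le_mul_right _ (Finset.card_le_card ?_))
      (card_monochromatic_mul_le (ι := U) (t := t) (x := ⟨x, hx⟩) (y := ⟨y, hy⟩) (z := ⟨z, hz⟩)
        (by simpa using hxy) (by simpa using hxz) (by simpa using hyz))
    intro f hf
    simp only [Finset.mem_filter, Finset.mem_univ, true_and] at hf ⊢
    obtain ⟨c, hc⟩ := hf
    rw [hc ⟨x, hx⟩ (by simp), hc ⟨y, hy⟩ (by simp), hc ⟨z, hz⟩ (by simp)]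
    simp
  obtain ⟨f, -, hf⟩ : ∃ f ∈ (Finset.univ : Finset (U → Fin t)),
      (E.filter fun e => ∃ c, mono f e c).card * t ^ 2 ≤ E.card := by
    have : Nonempty (Fin t) := ⟨⟨0, ht⟩⟩
    refine Finset.exists_le_of_sum_le Finset.univ_nonempty ?_
    rw [← Finset.sum_mul]
    simp_rw [Finset.card_filter]
    rw [Finset.sum_comm, Finset.sum_mul]
    calc _ ≤ ∑ e ∈ E, Fintype.card (U → Fin t) := Finset.sum_le_sum fun e he => by
            rw [← Finset.card_filter]; exact hbound e he
      _ = _ := by simp [mul_comm]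
  let cls : Fin t → Finset α := fun c => (Finset.univ.filter fun u : U => f u = c).image (↑)
  have hcls : ∀ c, (cls c).card = (Finset.univ.filter fun u : U => f u = c).card := fun c =>
    Finset.card_image_of_injective _ Subtype.val_injective
  have hsum1 : ∑ c, (cls c).card = U.card := by
    simp_rw [hcls]
    rw [← Finset.card_eq_sum_card_fiberwise (fun _ _ => by simp)]
    simp
  have hsum2 : ∑ c, (E.filter fun e => mono f e c).card ≤
      (E.filter fun e => ∃ c, mono f e c).card := by
    rw [← Finset.card_biUnion]
    · refine Finset.card_le_card fun e he => ?_
      simp only [Finset.mem_biUnion, Finset.mem_filter, Finset.mem_univ, true_and] at he ⊢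
      obtain ⟨c, h1, h2⟩ := he
      exact ⟨h1, c, h2⟩
    · intro c _ c' _ hcc
      rw [Function.onFun, Finset.disjoint_left]
      intro e he he'
      rw [Finset.mem_filter] at he he'
      obtain ⟨u, hu⟩ : e.Nonempty := Finset.card_pos.1 (by rw [hE e he.1]; norm_num)
      have huU := hEU e he.1 hu
      exact hcc ((he.2 ⟨u, huU⟩ hu).symm.trans (he'.2 ⟨u, huU⟩ hu))
  obtain ⟨c, hc⟩ : ∃ c, U.card + 2 * t * (E.filter fun e => mono f e c).card ≤
      2 * t * (cls c).card := by
    by_contra! hcon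
    have h1 : ∑ c : Fin t, 2 * t * (cls c).card <
        ∑ c : Fin t, (U.card + 2 * t * (E.filter fun e => mono f e c).card) :=
      Finset.sum_lt_sum_of_nonempty ⟨⟨0, ht⟩, by simp⟩ fun c _ => hcon c
    rw [Finset.sum_add_distrib, ← Finset.mul_sum, ← Finset.mul_sum, hsum1] at h1
    simp only [Finset.sum_const, Finset.card_univ, Fintype.card_fin, smul_eq_mul] at h1
    have h2 := Nat.mul_le_mul_left (2 * t) hsum2
    have h3 : 2 * (E.filter fun e => ∃ c, mono f e c).card ≤ U.card := by
      have : 0 < t ^ 2 := by positivity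
      refine le_of_mul_le_mul_left (a := t ^ 2) ?_ this
      linarith
    nlinarith
  have hne : ∀ e ∈ E, e.Nonempty := fun e he => Finset.card_pos.1 (by rw [hE e he]; norm_num)
  choose! g hg using hne
  refine ⟨cls c \ (E.filter fun e => mono f e c).image g, ?_, ?_, ?_⟩
  · intro x hx
    obtain ⟨u, -, rfl⟩ := Finset.mem_image.1 (Finset.mem_sdiff.1 hx).1
    exact u.2
  · intro e he hsub
    have hm : mono f e c := by
      intro u hu
      obtain ⟨u', hu', h'⟩ := Finset.mem_image.1 (Finset.mem_sdiff.1 (hsub hu)).1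
      rw [← Subtype.ext h']
      exact (Finset.mem_filter.1 hu').2
    exact (Finset.mem_sdiff.1 (hsub (hg e he))).2
      (Finset.mem_image.2 ⟨e, Finset.mem_filter.2 ⟨he, hm⟩, rfl⟩)
  · have h1 := Finset.le_card_sdiff ((E.filter fun e => mono f e c).image g) (cls c)
    have h2 : ((E.filter fun e => mono f e c).image g).card ≤ (E.filter fun e => mono f e c).card :=
      Finset.card_image_le
    have h3 : (cls c).card ≤ (cls c \ (E.filter fun e => mono f e c).image g).card +
      (E.filter fun e => mono f e c).card := by omega
    have h4 := Nat.mul_le_mul_left (2 * t) h3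
    rw [mul_add] at h4
    omega

end TripleSystem

namespace TripleSystem

variable {α : Type*}

/-! ### Levels of a search forest -/

/-- `L` is the level of depth `i` of a search forest that uses only vertices of `R ⊆ U`, and
`anc j x` is the ancestor of `x ∈ L` at depth `j`, where depth `0` is a common virtual root. Two
vertices of `L` that separate after depth `j` are joined by a loose path of length `2 * (i - j)`
that avoids a prescribed small set of vertices outside the earlier levels. -/
structure Level [DecidableEq α] (E : Finset (Finset α)) (U : Finset α) (l i : ℕ) (R L : Finset α)
    (anc : ℕ → α → α) : Prop where
  subset : L ⊆ R
  subset_univ : R ⊆ U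
  anc_zero : ∀ x ∈ L, ∀ y ∈ L, anc 0 x = anc 0 y
  anc_self : ∀ x ∈ L, anc i x = x
  link : ∀ j < i, ∀ x ∈ L, ∀ x' ∈ L, anc j x = anc j x' → anc (j + 1) x ≠ anc (j + 1) x' →
    ∀ S : Finset α, S.card + 4 * i ≤ 8 * l → x ∉ S → x' ∉ S → (∀ z ∈ S, z ∈ R → z ∈ L) →
      ∃ P, P.length = 2 * (i - j) ∧ Walk E x P x' ∧ (x :: verts P).Nodup ∧ ∀ z ∈ verts P, z ∉ S

/-- A new link climbs from `y` to its parent, follows the old link between the parents (empty if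
they coincide), and descends to `y'`. The old link must also avoid `y`, `y'`, `w y`, `w y'`; these
four vertices account for the term `4 * i` in the budget. -/
theorem Level.succ [DecidableEq α] {E : Finset (Finset α)} {U : Finset α} {l i : ℕ}
    {R L : Finset α} {anc : ℕ → α → α} (hE : ∀ e ∈ E, e.card = 3) (hL : Level E U l i R L anc)
    {L' : Finset α} {π w : α → α}
    (hU : ∀ y ∈ L', y ∈ U ∧ w y ∈ U) (hR : ∀ y ∈ L', y ∉ R ∧ w y ∉ R) (hπ : ∀ y ∈ L', π y ∈ L)
    (hedge : ∀ y ∈ L', ({y, w y, π y} : Finset α) ∈ E)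
    (hyw : ∀ y ∈ L', ∀ y' ∈ L', y ≠ w y') (hw : ∀ y ∈ L', ∀ y' ∈ L', w y = w y' → y = y') :
    Level E U l (i + 1) (R ∪ L' ∪ L'.image w) L'
      (fun k y => if k ≤ i then anc k (π y) else y) := by
  refine ⟨?_, ?_, ?_, ?_, ?_⟩
  · intro y hy
    simp [hy]
  · intro z hz
    simp only [Finset.mem_union, Finset.mem_image] at hz
    rcases hz with (hz | hz) | ⟨y, hy, rfl⟩
    · exact hL.subset_univ hz
    · exact (hU z hz).1
    · exact (hU y hy).2
  · intro x hx y hy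
    simpa using hL.anc_zero _ (hπ x hx) _ (hπ y hy)
  · intro x hx
    simp
  · intro j hj y hy y' hy' hjj hjj' S hS hyS hyS' hSR
    -- The forbidden set may meet the used vertices only in the new level, so it misses all earlier
    -- levels and the old link applies.
    have hLR : ∀ z ∈ S, z ∉ R := fun z hz hzR =>
      (hR z (hSR z hz (by simp [hzR]))).1 hzR
    have hwS : ∀ x ∈ L', w x ∉ S := fun x hx hxS =>
      hyw _ (hSR _ hxS (by
        simp only [Finset.mem_union, Finset.mem_image]; exact Or.inr ⟨x, hx, rfl⟩)) x hx rfl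
    have hπR : ∀ x ∈ L', π x ∈ R := fun x hx => hL.subset (hπ x hx)
    have hne : y ≠ y' := by
      rintro rfl; exact hjj' rfl
    obtain ⟨h1, h2, h3⟩ := ne_of_mem hE (hedge y hy)
    obtain ⟨h1', h2', h3'⟩ := ne_of_mem hE (hedge y' hy')
    have e' : ({π y', w y', y'} : Finset α) ∈ E :=
      swap_left (swap_right (swap_left (hedge y' hy')))
    have hww : w y ≠ w y' := fun h => hne (hw y hy y' hy' h)
    by_cases hji : j = i
    · subst hji
      simp only [le_refl, if_true] at hjj
      rw [hL.anc_self _ (hπ y hy), hL.anc_self _ (hπ y' hy')] at hjj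
      refine ⟨[(w y, π y), (w y', y')], by simp, ⟨hedge y hy, by rw [hjj]; exact e', rfl⟩, ?_, ?_⟩
      · rw [← hjj] at h2' h3'
        simp [hne, h1, h2, h3, hyw y hy y' hy', hww, h1'.symm, h3'.symm, h2'.symm,
          (hyw y' hy' y hy).symm]
      · intro z hz
        simp only [verts_cons, verts_nil, List.mem_cons, List.not_mem_nil, or_false] at hz
        rcases hz with rfl | rfl | rfl | rfl
        · exact hwS y hy
        · exact fun h => hLR _ h (hπR y hy)
        · exact hwS y' hy'
        · exact hyS'
    · have hj' : j < i := by omega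
      simp only [hj'.le, if_true, Nat.succ_le_of_lt hj'] at hjj hjj'
      obtain ⟨P, hlen, hP, hnd, hav⟩ := hL.link j hj' _ (hπ y hy) _ (hπ y' hy') hjj hjj'
        (S ∪ {y, y', w y, w y'}) (by
          have := Finset.card_union_le S {y, y', w y, w y'}
          have := Finset.card_le_four (a := y) (b := y') (c := w y) (d := w y')
          omega) (by
          have := hπR y hy
          have h4 : π y ∉ S := fun h => hLR _ h this
          have : ∀ x, x ∉ R → π y ≠ x := fun x hx h => hx (h ▸ this)
          simp [h4, this _ (hR y hy).1, this _ (hR y hy).2, this _ (hR y' hy').1,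
            this _ (hR y' hy').2]) (by
          have := hπR y' hy'
          have h4 : π y' ∉ S := fun h => hLR _ h this
          have : ∀ x, x ∉ R → π y' ≠ x := fun x hx h => hx (h ▸ this)
          simp [h4, this _ (hR y hy).1, this _ (hR y hy).2, this _ (hR y' hy').1,
            this _ (hR y' hy').2]) (by
          intro z hz hzR
          simp only [Finset.mem_union, Finset.mem_insert, Finset.mem_singleton] at hz
          rcases hz with hz | rfl | rfl | rfl | rfl
          · exact absurd hzR (hLR z hz)
          · exact absurd hzR (hR _ hy).1
          · exact absurd hzR (hR _ hy').1
          · exact absurd hzR (hR _ hy).2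
          · exact absurd hzR (hR _ hy').2)
      have hav' : ∀ z ∈ verts P, z ∉ S ∧ z ≠ y ∧ z ≠ y' ∧ z ≠ w y ∧ z ≠ w y' := by
        intro z hz
        have := hav z hz
        simpa only [Finset.mem_union, Finset.mem_insert, Finset.mem_singleton, not_or] using this
      rw [List.nodup_cons] at hnd
      refine ⟨(w y, π y) :: (P ++ [(w y', y')]), by simp [hlen]; omega,
        ⟨hedge y hy, hP.append ⟨e', rfl⟩⟩, ?_, ?_⟩
      · have n1 : y ∉ verts P := fun h => (hav' _ h).2.1 rfl
        have n2 : y' ∉ verts P := fun h => (hav' _ h).2.2.1 rfl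
        have n3 : w y ∉ verts P := fun h => (hav' _ h).2.2.2.1 rfl
        have n4 : w y' ∉ verts P := fun h => (hav' _ h).2.2.2.2 rfl
        have n5 : π y ≠ w y' := fun h => (hR y' hy').2 (h ▸ hπR y hy)
        have n6 : π y ≠ y' := fun h => (hR y' hy').1 (h ▸ hπR y hy)
        simp only [verts_cons, verts_append, verts_nil, List.nodup_cons, List.mem_cons,
          List.mem_append, List.nodup_append, List.not_mem_nil, or_false, not_or]
        refine ⟨⟨h1, h2, n1, hyw y hy y' hy', hne⟩, ⟨h3, n3, hww, (hyw y' hy' y hy).symm⟩,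
          ⟨hnd.1, n5, n6⟩, hnd.2, ⟨h1'.symm, not_false, List.nodup_nil⟩, ?_⟩
        rintro z hz z' (rfl | rfl)
        · exact (hav' z hz).2.2.2.2
        · exact (hav' z hz).2.2.1
      · intro z hz
        simp only [verts_cons, verts_append, verts_nil, List.mem_cons, List.mem_append,
          List.not_mem_nil, or_false] at hz
        rcases hz with rfl | rfl | hz | rfl | rfl
        · exact hwS y hy
        · exact fun h => hLR _ h (hπR y hy)
        · exact (hav' z hz).1
        · exact hwS y' hy'
        · exact hyS'

/-! ### Greedy sparse subsets and the cycles they prevent -/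

variable [LinearOrder α]

/-- The vertex `v` has an edge to two vertices of `I` in its own class, one of them in an earlier
branch, or more than `M` vertices of `T` that form a triple with `v` and a vertex of `I` in the
class of `v` and in an earlier branch. Classes are given by `g` and branches by `f`. -/
def Linked (E : Finset (Finset α)) (g f : α → α) (T : Finset α) (M : ℕ) (v : α) (I : Finset α) :
    Prop :=
  (∃ a ∈ I, ∃ b ∈ I, ({v, a, b} : Finset α) ∈ E ∧ g a = g v ∧ g b = g v ∧ f a < f v) ∨
    M < (T.filter fun y => ∃ a ∈ I, g a = g v ∧ f a < f v ∧ ({v, a, y} : Finset α) ∈ E).card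

theorem Linked.mono {E : Finset (Finset α)} {g f : α → α} {T : Finset α} {M : ℕ} {v : α}
    {I J : Finset α} (h : Linked E g f T M v I) (hIJ : I ⊆ J) : Linked E g f T M v J := by
  rcases h with ⟨a, ha, b, hb, h⟩ | h
  · exact Or.inl ⟨a, hIJ ha, b, hIJ hb, h⟩
  · refine Or.inr (h.trans_le (Finset.card_le_card fun y hy => ?_))
    rw [Finset.mem_filter] at hy ⊢
    obtain ⟨h1, a, ha, h2⟩ := hy
    exact ⟨h1, a, hIJ ha, h2⟩

/-- Every edge inside a class of `I` lies in a single branch, and the pairs of `I` in one class but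
in different branches form triples with at most `M * |I|` vertices of `T`. -/
def Sparse (E : Finset (Finset α)) (g f : α → α) (T : Finset α) (M : ℕ) (I : Finset α) : Prop :=
  (∀ a ∈ I, ∀ b ∈ I, ∀ c ∈ I, ({a, b, c} : Finset α) ∈ E → g a = g b → g a = g c →
    f a = f b ∧ f a = f c) ∧
  (T.filter fun y => ∃ a ∈ I, ∃ b ∈ I, g a = g b ∧ f a ≠ f b ∧ ({a, b, y} : Finset α) ∈ E).card ≤
    M * I.card

/-- Greedy choice in order of increasing branch `f`: a vertex is accepted unless it is linked to the
vertices accepted so far. Thus a new vertex creates no edge across branches of its class and at most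
`M` new tips, while every rejected vertex has links into earlier branches. -/
theorem exists_sparse (E : Finset (Finset α)) (hE : ∀ e ∈ E, e.card = 3) (g f : α → α)
    (T : Finset α) (M : ℕ) (W : Finset α) :
    ∃ I ⊆ W, Sparse E g f T M I ∧ ∀ v ∈ W, v ∉ I → Linked E g f T M v I := by
  induction W using Finset.induction_on_max_value f with
  | empty => exact ⟨∅, subset_rfl, ⟨by simp, by simp⟩, by simp⟩
  | insert v s hv hmax ih =>
    obtain ⟨I, hIs, ⟨hI1, hI2⟩, hI3⟩ := ih
    by_cases hlink : Linked E g f T M v I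
    · refine ⟨I, hIs.trans (Finset.subset_insert _ _), ⟨hI1, hI2⟩, fun u hu huI => ?_⟩
      rcases Finset.mem_insert.1 hu with rfl | hu
      · exact hlink
      · exact hI3 u hu huI
    · have hlink' := hlink
      rw [Linked, not_or] at hlink'
      obtain ⟨hno, hfew⟩ := hlink'
      push Not at hno hfew
      have hvI : v ∉ I := fun h => hv (hIs h)
      have key : ∀ a ∈ I, ∀ b ∈ I, ({v, a, b} : Finset α) ∈ E → g v = g a → g v = g b →
          f v = f a ∧ f v = f b := by
        intro a ha b hb he hga hgb
        have h1 := hno a ha b hb he hga.symm hgb.symm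
        have h2 := hno b hb a ha (swap_right he) hgb.symm hga.symm
        exact ⟨le_antisymm h1 (hmax a (hIs ha)), le_antisymm h2 (hmax b (hIs hb))⟩
      refine ⟨insert v I, Finset.insert_subset_insert _ hIs, ⟨?_, ?_⟩, fun u hu huI => ?_⟩
      · intro a ha b hb c hc he hgb hgc
        obtain ⟨hab, hac, hbc⟩ := ne_of_mem hE he
        rcases Finset.mem_insert.1 ha with rfl | ha'
        · exact key b (Finset.mem_of_mem_insert_of_ne hb hab.symm) c
            (Finset.mem_of_mem_insert_of_ne hc hac.symm) he hgb hgc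
        rcases Finset.mem_insert.1 hb with rfl | hb'
        · have := key a ha' c (Finset.mem_of_mem_insert_of_ne hc hbc.symm) (swap_left he)
            hgb.symm (hgb.symm.trans hgc)
          exact ⟨this.1.symm, this.1.symm.trans this.2⟩
        rcases Finset.mem_insert.1 hc with rfl | hc'
        · have := key a ha' b hb' (swap_left (swap_right he)) hgc.symm (hgc.symm.trans hgb)
          exact ⟨this.1.symm.trans this.2, this.1.symm⟩
        · exact hI1 a ha' b hb' c hc' he hgb hgc
      · rw [Finset.card_insert_of_notMem hvI, mul_add, mul_one]
        refine le_trans ?_ (Nat.add_le_add hI2 hfew)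
        refine le_trans (Finset.card_le_card ?_) (Finset.card_union_le _ _)
        intro y hy
        rw [Finset.mem_filter] at hy
        obtain ⟨hyT, a, ha, b, hb, hg, hf, he⟩ := hy
        rw [Finset.mem_union, Finset.mem_filter, Finset.mem_filter]
        have hab := (ne_of_mem hE he).1
        rcases Finset.mem_insert.1 ha with rfl | ha'
        · have hb' := Finset.mem_of_mem_insert_of_ne hb hab.symm
          exact Or.inr ⟨hyT, b, hb', hg.symm, lt_of_le_of_ne (hmax b (hIs hb')) hf.symm, he⟩
        rcases Finset.mem_insert.1 hb with rfl | hb'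
        · exact Or.inr ⟨hyT, a, ha', hg, lt_of_le_of_ne (hmax a (hIs ha')) hf, swap_left he⟩
        · exact Or.inl ⟨hyT, a, ha', b, hb', hg, hf, he⟩
      · rw [Finset.mem_insert, not_or] at huI
        exact (hI3 u (Finset.mem_of_mem_insert_of_ne hu huI.1) huI.2).mono
          (Finset.subset_insert _ _)

/-- Each round removes a greedy sparse set `I`, and a surviving vertex steps into `I`, in its own
class and in an earlier branch, whence the previous rounds continue the walk. Level vertices do not
repeat because the continuation uses only vertices removed in earlier rounds; vertices of `T` do not
repeat because each is added to the forbidden set, with more than `M` candidates at hand. -/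
theorem exists_descending_walks {E : Finset (Finset α)} (hE : ∀ e ∈ E, e.card = 3) {g f : α → α}
    {T : Finset α} {M : ℕ} {W : Finset α} (hTW : Disjoint T W) {b : ℕ}
    (hb : ∀ I ⊆ W, Sparse E g f T M I → I.card ≤ b) (k : ℕ) :
    ∃ W' ⊆ W, W.card ≤ W'.card + k * b ∧ ∀ v ∈ W', ∀ S : Finset α, S.card + k ≤ M + 1 →
      ∃ P x, P.length = k ∧ Walk E v P x ∧ (v :: verts P).Nodup ∧ x ∈ W ∧ g x = g v ∧ f x ≤ f v ∧
        (k ≠ 0 → f x < f v) ∧ ∀ z ∈ verts P, (z ∈ W ∧ z ∉ W') ∨ (z ∈ T ∧ z ∉ S) := by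
  induction k with
  | zero =>
    exact ⟨W, subset_rfl, by simp, fun v hv S _ => ⟨[], v, rfl, rfl, by simp, hv, rfl, le_rfl,
      by simp, by simp⟩⟩
  | succ k ih =>
    obtain ⟨W', hW', hcard, hwalk⟩ := ih
    obtain ⟨I, hI, hsp, hlink⟩ := exists_sparse E hE g f T M W'
    have hIb := hb I (hI.trans hW') hsp
    refine ⟨W' \ I, Finset.sdiff_subset.trans hW', ?_, ?_⟩
    · have := Finset.card_sdiff_of_subset hI
      have := Finset.card_le_card hI
      rw [add_mul, one_mul]
      omega
    · intro v hv S hS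
      rw [Finset.mem_sdiff] at hv
      have hout : ∀ (P : List (α × α)) (S : Finset α), (∀ z ∈ verts P,
          (z ∈ W ∧ z ∉ W') ∨ (z ∈ T ∧ z ∉ S)) → ∀ u ∈ W', u ∉ verts P := by
        intro P S hP u hu hmem
        rcases hP u hmem with h | h
        · exact h.2 hu
        · exact Finset.disjoint_left.1 hTW h.1 (hW' hu)
      rcases hlink v hv.1 hv.2 with ⟨a, ha, c, hc, he, hga, hgc, hfa⟩ | hmany
      · obtain ⟨P, x, hlen, hP, hnd, hx, hgx, hfx, -, hz⟩ := hwalk a (hI ha) S (by omega)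
        obtain ⟨hva, hvc, hac⟩ := ne_of_mem hE he
        have h1 := hout P S hz v hv.1
        have h2 := hout P S hz c (hI hc)
        refine ⟨(c, a) :: P, x, by simp [hlen], ⟨swap_right he, hP⟩, ?_, hx, hgx.trans hga,
          hfx.trans hfa.le, fun _ => hfx.trans_lt hfa, ?_⟩
        · rw [List.nodup_cons] at hnd
          simp [hva, hvc, h1, h2, hac.symm, hnd.1, hnd.2]
        · intro z hzm
          rw [verts_cons] at hzm
          simp only [List.mem_cons, Finset.mem_sdiff] at hzm ⊢
          rcases hzm with rfl | rfl | hzm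
          · exact Or.inl ⟨hW' (hI hc), fun h => h.2 hc⟩
          · exact Or.inl ⟨hW' (hI ha), fun h => h.2 ha⟩
          · rcases hz z hzm with h | h
            · exact Or.inl ⟨h.1, fun h' => h.2 h'.1⟩
            · exact Or.inr h
      · obtain ⟨y, hy, hyS⟩ := Finset.exists_mem_notMem_of_card_lt_card
          (lt_of_le_of_lt (by omega : S.card ≤ M) hmany)
        rw [Finset.mem_filter] at hy
        obtain ⟨hyT, a, ha, hga, hfa, he⟩ := hy
        obtain ⟨P, x, hlen, hP, hnd, hx, hgx, hfx, -, hz⟩ := hwalk a (hI ha) (insert y S) (by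
          have := Finset.card_insert_le y S
          omega)
        obtain ⟨hva, hvy, hay⟩ := ne_of_mem hE he
        have h1 := hout P _ hz v hv.1
        have h2 : y ∉ verts P := by
          intro h
          rcases hz y h with h | h
          · exact Finset.disjoint_left.1 hTW hyT h.1
          · exact h.2 (Finset.mem_insert_self _ _)
        refine ⟨(y, a) :: P, x, by simp [hlen], ⟨swap_right he, hP⟩, ?_, hx, hgx.trans hga,
          hfx.trans hfa.le, fun _ => hfx.trans_lt hfa, ?_⟩
        · rw [List.nodup_cons] at hnd
          simp [hva, hvy, h1, h2, hay.symm, hnd.1, hnd.2]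
        · intro z hzm
          rw [verts_cons] at hzm
          simp only [List.mem_cons, Finset.mem_sdiff] at hzm ⊢
          rcases hzm with rfl | rfl | hzm
          · exact Or.inr ⟨hyT, hyS⟩
          · exact Or.inl ⟨hW' (hI ha), fun h => h.2 ha⟩
          · rcases hz z hzm with h | h
            · exact Or.inl ⟨h.1, fun h' => h.2 h'.1⟩
            · exact Or.inr ⟨h.1, fun h' => h.2 (Finset.mem_insert_of_mem h')⟩

theorem Level.exists_sparse_subset {E : Finset (Finset α)} {U : Finset α} {l i : ℕ}
    {R L : Finset α} {anc : ℕ → α → α} (hE : ∀ e ∈ E, e.card = 3) (hfree : CycleFree E l)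
    (hL : Level E U l i R L anc) (hil : 2 * i < l) {j : ℕ} (hj : j < i) {W : Finset α}
    (hW : W ⊆ L) :
    ∃ I ⊆ W, Sparse E (anc j) (anc (j + 1)) (U \ R) l I ∧ W.card ≤ l * I.card := by
  by_contra! hcon
  have hlpos : 0 < l := by omega
  have hWpos : 0 < W.card := by
    have := hcon ∅ (by simp) ⟨by simp, by simp⟩
    omega
  have hdisj : Disjoint (U \ R) W := by
    rw [Finset.disjoint_left]
    intro x hx hxW
    exact (Finset.mem_sdiff.1 hx).2 (hL.subset (hW hxW))
  -- `(W.card - 1) / l` is the largest size allowed by `l * |I| < |W|`; fewer than `l` rounds then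
  -- cannot exhaust `W`.
  obtain ⟨W', hW', hcard, hwalk⟩ := exists_descending_walks hE hdisj (b := (W.card - 1) / l)
    (fun I hI hsp => by
      rw [Nat.le_div_iff_mul_le hlpos, mul_comm]
      have := hcon I hI hsp
      omega) (l - 2 * (i - j))
  have hb : (l - 2 * (i - j)) * ((W.card - 1) / l) < W.card := by
    have h1 : (l - 2 * (i - j)) * ((W.card - 1) / l) ≤ l * ((W.card - 1) / l) :=
      Nat.mul_le_mul_right _ (by omega)
    have h2 := Nat.mul_div_le (W.card - 1) l
    omega
  obtain ⟨v, hv⟩ : W'.Nonempty := Finset.card_pos.1 (by omega)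
  obtain ⟨P, x, hlen, hP, hnd, hx, hgx, -, hfx, hz⟩ := hwalk v hv ∅ (by simp; omega)
  have hfx := hfx (by omega)
  rw [List.nodup_cons] at hnd
  have hxP : x ∈ verts P := hP.end_mem (by rintro rfl; simp at hlen; omega)
  -- The walk lies in `L` and in unused vertices, which is exactly what a link can be asked to
  -- avoid. Its endpoint `x` is exempt, being the start of the link.
  obtain ⟨Q, hQlen, hQ, hQnd, hQav⟩ := hL.link j hj x (hW hx) v (hW (hW' hv)) hgx hfx.ne
    ((verts P).toFinset.erase x) (by
      have h1 := Finset.card_erase_le (s := (verts P).toFinset) (a := x)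
      have h2 := List.toFinset_card_le (verts P)
      rw [length_verts] at h2
      omega) (by simp) (by simp [hnd.1]) (by
      intro z hzm hzR
      rw [Finset.mem_erase, List.mem_toFinset] at hzm
      rcases hz z hzm.2 with h | h
      · exact hW h.1
      · exact absurd hzR (Finset.mem_sdiff.1 h.1).2)
  rw [List.nodup_cons] at hQnd
  refine hfree v (P ++ Q) (hP.append hQ) (by simp [hlen, hQlen]; omega) ?_
  rw [verts_append, List.nodup_append]
  refine ⟨hnd.2, hQnd.2, ?_⟩
  rintro z hzP z' hzQ rfl
  by_cases hzx : z = x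
  · exact hQnd.1 (hzx ▸ hzQ)
  · exact hQav z hzQ (by simp [hzx, hzP])

/-- The vertices of `T` that form a triple with two vertices of `X` in a common class of `g`. -/
def tips (E : Finset (Finset α)) (T : Finset α) (g : α → α) (X : Finset α) : Finset α :=
  T.filter fun y => ∃ a ∈ X, ∃ b ∈ X, g a = g b ∧ ({a, b, y} : Finset α) ∈ E

/-- Induction from the finest partition, where classes are single vertices, to coarser ones. Passing
up one depth costs a factor `l` in size. A triple inside a coarser class would lie in one branch,
that is, in a finer class; new tips come only from pairs in different branches. -/
theorem Level.exists_indep_classes {E : Finset (Finset α)} {U : Finset α} {l i : ℕ}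
    {R L : Finset α} {anc : ℕ → α → α} (hE : ∀ e ∈ E, e.card = 3) (hfree : CycleFree E l)
    (hL : Level E U l i R L anc) (hil : 2 * i < l) (t : ℕ) (ht : t ≤ i) :
    ∃ W ⊆ L, L.card ≤ l ^ t * W.card ∧
      (∀ a ∈ W, ∀ b ∈ W, ∀ c ∈ W, ({a, b, c} : Finset α) ∈ E → anc (i - t) a = anc (i - t) b →
        anc (i - t) a = anc (i - t) c → False) ∧
      (tips E (U \ R) (anc (i - t)) W).card ≤ l * t * l ^ t * W.card := by
  induction t with
  | zero =>
    refine ⟨L, subset_rfl, by simp, ?_, ?_⟩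
    · intro a ha b hb c hc he hab _
      rw [Nat.sub_zero, hL.anc_self a ha, hL.anc_self b hb] at hab
      exact (ne_of_mem hE he).1 hab
    · rw [tips, Finset.filter_eq_empty_iff.2]
      · simp
      · rintro y - ⟨a, ha, b, hb, hab, he⟩
        rw [Nat.sub_zero, hL.anc_self a ha, hL.anc_self b hb] at hab
        exact (ne_of_mem hE he).1 hab
  | succ t ih =>
    obtain ⟨W, hW, hcard, hno, htips⟩ := ih (by omega)
    have hit : i - t = i - (t + 1) + 1 := by omega
    rw [hit] at hno htips
    obtain ⟨I, hI, ⟨hI1, hI2⟩, hWI⟩ := hL.exists_sparse_subset hE hfree hil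
      (j := i - (t + 1)) (by omega) hW
    refine ⟨I, hI.trans hW, ?_, ?_, ?_⟩
    · calc L.card ≤ l ^ t * W.card := hcard
        _ ≤ l ^ t * (l * I.card) := Nat.mul_le_mul_left _ hWI
        _ = l ^ (t + 1) * I.card := by ring
    · intro a ha b hb c hc he hab hac
      obtain ⟨h1, h2⟩ := hI1 a ha b hb c hc he hab hac
      exact hno a (hI ha) b (hI hb) c (hI hc) he h1 h2
    · have h1 : (tips E (U \ R) (anc (i - (t + 1))) I).card ≤
          l * t * l ^ t * W.card + l * I.card := by
        refine le_trans ?_ (Nat.add_le_add htips hI2)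
        refine le_trans (Finset.card_le_card ?_) (Finset.card_union_le _ _)
        intro y hy
        rw [tips, Finset.mem_filter] at hy
        obtain ⟨hyT, a, ha, b, hb, hg, he⟩ := hy
        rw [Finset.mem_union, tips, Finset.mem_filter, Finset.mem_filter]
        by_cases hf : anc (i - (t + 1) + 1) a = anc (i - (t + 1) + 1) b
        · exact Or.inl ⟨hyT, a, hI ha, b, hI hb, hf, he⟩
        · exact Or.inr ⟨hyT, a, ha, b, hb, hg, hf, he⟩
      calc _ ≤ _ := h1
        _ ≤ l * t * l ^ t * (l * I.card) + l * I.card :=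
          Nat.add_le_add_right (Nat.mul_le_mul_left _ hWI) _
        _ = l * t * l ^ (t + 1) * I.card + l * 1 * I.card := by ring
        _ ≤ l * t * l ^ (t + 1) * I.card + l * l ^ (t + 1) * I.card := by
          gcongr
          exact Nat.one_le_pow _ _ (by omega)
        _ = _ := by ring

theorem Level.exists_indep {E : Finset (Finset α)} {U : Finset α} {l i : ℕ}
    {R L : Finset α} {anc : ℕ → α → α} (hE : ∀ e ∈ E, e.card = 3) (hfree : CycleFree E l)
    (hL : Level E U l i R L anc) (hil : 2 * i < l) :
    ∃ X ⊆ L, L.card ≤ l ^ i * X.card ∧ Indep E X ∧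
      ((U \ R).filter fun y => ∃ a ∈ X, ∃ b ∈ X, ({a, b, y} : Finset α) ∈ E).card ≤
        l * i * l ^ i * X.card := by
  obtain ⟨X, hX, hcard, hno, htips⟩ := hL.exists_indep_classes hE hfree hil i le_rfl
  rw [Nat.sub_self] at hno htips
  have hz : ∀ a ∈ X, ∀ b ∈ X, anc 0 a = anc 0 b := fun a ha b hb =>
    hL.anc_zero a (hX ha) b (hX hb)
  refine ⟨X, hX, hcard, ?_, le_trans (Finset.card_le_card ?_) htips⟩
  · intro e he hsub
    obtain ⟨a, b, c, -, -, -, rfl⟩ := Finset.card_eq_three.1 (hE e he)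
    have ha := hsub (by simp : a ∈ ({a, b, c} : Finset α))
    have hb := hsub (by simp : b ∈ ({a, b, c} : Finset α))
    have hc := hsub (by simp : c ∈ ({a, b, c} : Finset α))
    exact hno a ha b hb c hc he (hz a ha b hb) (hz a ha c hc)
  · intro y hy
    rw [Finset.mem_filter] at hy
    obtain ⟨hyT, a, ha, b, hb, he⟩ := hy
    exact Finset.mem_filter.2 ⟨hyT, a, ha, b, hb, hz a ha b hb, he⟩

/-! ### Expansion -/

/-- In the vertex set `U`, deleting at most `D * |X|` vertices never isolates the set `X`. -/
def Expands (E : Finset (Finset α)) (U : Finset α) (D : ℕ) : Prop :=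
  ∀ X ⊆ U, X.Nonempty → ∀ T ⊆ U, X ⊆ T → T.card ≤ D * X.card →
    ∃ e ∈ E, e ⊆ X ∪ (U \ T) ∧ ∃ z ∈ e, z ∈ X

/-- Take a maximal family of triples with one vertex in `X` and disjoint pairs outside `R`. If the
used vertices and the tips of `X` numbered at most `D * |X|`, expansion would give another triple
meeting `X`: with one vertex in `X` it enlarges the family, with two its third vertex is a tip, with
three it contradicts independence. -/
theorem exists_disjoint_family {E : Finset (Finset α)} {U : Finset α} {D : ℕ} {R X : Finset α}
    (hE : ∀ e ∈ E, e.card = 3) (hexp : Expands E U D) (hRU : R ⊆ U) (hXR : X ⊆ R)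
    (hXne : X.Nonempty) (hX : Indep E X) :
    ∃ (L : Finset α) (π w : α → α), (∀ y ∈ L, y ∈ U ∧ w y ∈ U) ∧ (∀ y ∈ L, y ∉ R ∧ w y ∉ R) ∧
      (∀ y ∈ L, π y ∈ X) ∧ (∀ y ∈ L, ({y, w y, π y} : Finset α) ∈ E) ∧
      (∀ y ∈ L, ∀ y' ∈ L, y ≠ w y') ∧ (∀ y ∈ L, ∀ y' ∈ L, w y = w y' → y = y') ∧
      D * X.card < R.card +
        ((U \ R).filter fun y => ∃ a ∈ X, ∃ b ∈ X, ({a, b, y} : Finset α) ∈ E).card +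
        2 * L.card := by
  classical
  let good : Finset (α × α × α) → Prop := fun Q =>
    (∀ q ∈ Q, ({q.1, q.2.1, q.2.2} : Finset α) ∈ E) ∧
    (∀ q ∈ Q, ∀ q' ∈ Q, q.1 ≠ q'.2.1) ∧
    (∀ q ∈ Q, ∀ q' ∈ Q, q.1 = q'.1 → q = q') ∧ (∀ q ∈ Q, ∀ q' ∈ Q, q.2.1 = q'.2.1 → q = q')
  obtain ⟨Q, hQ, hQmax⟩ := Finset.exists_max_image
    ((((U \ R) ×ˢ (U \ R) ×ˢ X).powerset).filter good) Finset.card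
    ⟨∅, by simp [good]⟩
  rw [Finset.mem_filter, Finset.mem_powerset] at hQ
  obtain ⟨hQsub, hQE, hQ1, hQ2, hQ3⟩ := hQ
  have hmem : ∀ q ∈ Q, (q.1 ∈ U ∧ q.1 ∉ R) ∧ (q.2.1 ∈ U ∧ q.2.1 ∉ R) ∧ q.2.2 ∈ X := by
    intro q hq
    simpa only [Finset.mem_product, Finset.mem_sdiff] using hQsub hq
  have hex : ∀ y ∈ Q.image Prod.fst, ∃ q ∈ Q, q.1 = y := fun y hy => Finset.mem_image.1 hy
  have hne : Nonempty (α × α × α) := ⟨(hXne.choose, hXne.choose, hXne.choose)⟩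
  choose! s hs hsy using hex
  refine ⟨Q.image Prod.fst, fun y => (s y).2.2, fun y => (s y).2.1, ?_, ?_, ?_, ?_, ?_, ?_, ?_⟩
  · intro y hy
    have := hmem _ (hs y hy)
    exact ⟨hsy y hy ▸ this.1.1, this.2.1.1⟩
  · intro y hy
    have := hmem _ (hs y hy)
    exact ⟨hsy y hy ▸ this.1.2, this.2.1.2⟩
  · intro y hy
    exact (hmem _ (hs y hy)).2.2
  · intro y hy
    have := hQE _ (hs y hy)
    rwa [hsy y hy] at this
  · intro y hy y' hy' h
    refine hQ1 _ (hs y hy) _ (hs y' hy') ?_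
    rw [hsy y hy]; exact h
  · intro y hy y' hy' h
    rw [← hsy y hy, ← hsy y' hy', hQ3 _ (hs y hy) _ (hs y' hy') h]
  · rw [Finset.card_image_of_injOn (fun q hq q' hq' h => hQ2 q hq q' hq' h)]
    by_contra! hcon
    set Tp := (U \ R).filter fun y => ∃ a ∈ X, ∃ b ∈ X, ({a, b, y} : Finset α) ∈ E with hTp
    obtain ⟨e, he, hesub, z, hze, hzX⟩ := hexp X (hXR.trans hRU) hXne
      (R ∪ Tp ∪ (Q.image Prod.fst ∪ Q.image fun q => q.2.1)) (by
        refine Finset.union_subset (Finset.union_subset hRU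
          ((Finset.filter_subset _ _).trans Finset.sdiff_subset)) (Finset.union_subset ?_ ?_)
        · intro y hy
          obtain ⟨q, hq, rfl⟩ := Finset.mem_image.1 hy
          exact (hmem q hq).1.1
        · intro y hy
          obtain ⟨q, hq, rfl⟩ := Finset.mem_image.1 hy
          exact (hmem q hq).2.1.1)
      (fun x hx => by simp [hXR hx]) (by
        have h1 := Finset.card_union_le (R ∪ Tp) (Q.image Prod.fst ∪ Q.image fun q => q.2.1)
        have h2 := Finset.card_union_le R Tp
        have h3 := Finset.card_union_le (Q.image Prod.fst) (Q.image fun q => q.2.1)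
        have h4 : (Q.image Prod.fst).card ≤ Q.card := Finset.card_image_le
        have h5 : (Q.image fun q => q.2.1).card ≤ Q.card := Finset.card_image_le
        omega)
    obtain ⟨b, c, rfl⟩ : ∃ b c, e = {z, b, c} := by
      have h2 : (e.erase z).card = 2 := by rw [Finset.card_erase_of_mem hze, hE e he]
      obtain ⟨b, c, -, hbc⟩ := Finset.card_eq_two.1 h2
      exact ⟨b, c, by rw [← hbc, Finset.insert_erase hze]⟩
    obtain ⟨hzb, hzc, hbc⟩ := ne_of_mem hE he
    have hout : ∀ x ∈ ({z, b, c} : Finset α), x ∉ X → (x ∈ U ∧ x ∉ R) ∧ x ∉ Tp ∧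
        (∀ q ∈ Q, q.1 ≠ x) ∧ ∀ q ∈ Q, q.2.1 ≠ x := by
      intro x hx hxX
      have := hesub hx
      simp only [Finset.mem_union, hxX, false_or, Finset.mem_sdiff, not_or, Finset.mem_image,
        not_exists, not_and] at this
      exact ⟨⟨this.1, this.2.1.1⟩, this.2.1.2, this.2.2.1, this.2.2.2⟩
    have hb : b ∈ ({z, b, c} : Finset α) := by simp
    have hc : c ∈ ({z, b, c} : Finset α) := by simp
    by_cases hbX : b ∈ X
    · by_cases hcX : c ∈ X
      · refine hX _ he fun x hx => ?_
        simp only [Finset.mem_insert, Finset.mem_singleton] at hx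
        rcases hx with rfl | rfl | rfl <;> assumption
      · have := hout c hc hcX
        refine this.2.1 (Finset.mem_filter.2 ⟨Finset.mem_sdiff.2 this.1, z, hzX, b, hbX, he⟩)
    · have hb' := hout b hb hbX
      by_cases hcX : c ∈ X
      · exact hb'.2.1 (Finset.mem_filter.2 ⟨Finset.mem_sdiff.2 hb'.1, z, hzX, c, hcX,
          swap_right he⟩)
      · have hc' := hout c hc hcX
        have hnot : (b, c, z) ∉ Q := fun h => hb'.2.2.1 _ h rfl
        have := hQmax (insert (b, c, z) Q) (by
          rw [Finset.mem_filter, Finset.mem_powerset]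
          refine ⟨Finset.insert_subset (by simp [hb'.1, hc'.1, hzX]) hQsub, ?_, ?_, ?_, ?_⟩
          · intro q hq
            rcases Finset.mem_insert.1 hq with rfl | hq
            · exact swap_right (swap_left he)
            · exact hQE q hq
          · intro q hq q' hq' h
            rcases Finset.mem_insert.1 hq with rfl | hq <;>
              rcases Finset.mem_insert.1 hq' with rfl | hq'
            · exact hbc h
            · exact hb'.2.2.2 q' hq' h.symm
            · exact hc'.2.2.1 q hq h
            · exact hQ1 q hq q' hq' h
          · intro q hq q' hq' h
            rcases Finset.mem_insert.1 hq with rfl | hq <;>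
              rcases Finset.mem_insert.1 hq' with rfl | hq'
            · rfl
            · exact absurd h.symm (hb'.2.2.1 q' hq')
            · exact absurd h (hb'.2.2.1 q hq)
            · exact hQ2 q hq q' hq' h
          · intro q hq q' hq' h
            rcases Finset.mem_insert.1 hq with rfl | hq <;>
              rcases Finset.mem_insert.1 hq' with rfl | hq'
            · rfl
            · exact absurd h.symm (hc'.2.2.2 q' hq')
            · exact absurd h (hc'.2.2.2 q hq)
            · exact hQ3 q hq q' hq' h)
        rw [Finset.card_insert_of_notMem hnot] at this
        omega

end TripleSystem

universe u

namespace TripleSystem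

/-! ### The first level -/

/-- The graph joining `y` to `v y` has a vertex with at most one preimage, hence at most two
neighbours. Select it, delete these, and repeat. -/
theorem exists_free_subset {α : Type*} [DecidableEq α] (v : α → α) (Y : Finset α)
    (hv : ∀ y ∈ Y, v y ≠ y) :
    ∃ Z ⊆ Y, Y.card ≤ 3 * Z.card ∧ ∀ y ∈ Z, ∀ y' ∈ Z, y ≠ v y' := by
  induction Y using Finset.strongInduction with
  | H Y ih =>
  rcases Y.eq_empty_or_nonempty with rfl | hne
  · exact ⟨∅, by simp, by simp, by simp⟩
  obtain ⟨z, hz, hdeg⟩ : ∃ z ∈ Y, (Y.filter fun y => v y = z).card ≤ 1 := by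
    by_contra! hcon
    have h1 : ∑ z ∈ Y, 2 ≤ ∑ z ∈ Y, (Y.filter fun y => v y = z).card :=
      Finset.sum_le_sum fun z hz => hcon z hz
    have h2 : ∑ z ∈ Y, (Y.filter fun y => v y = z).card ≤ Y.card := by
      rw [← Finset.card_biUnion]
      · exact Finset.card_le_card (Finset.biUnion_subset.2 fun z _ => Finset.filter_subset _ _)
      · intro z _ z' _ hzz
        rw [Function.onFun, Finset.disjoint_left]
        intro y hy hy'
        exact hzz ((Finset.mem_filter.1 hy).2.symm.trans (Finset.mem_filter.1 hy').2)
    have := hne.card_pos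
    simp at h1
    omega
  obtain ⟨B, hB⟩ : ∃ B, B = insert z (insert (v z) (Y.filter fun y => v y = z)) := ⟨_, rfl⟩
  have hzB : z ∈ B := by simp [hB]
  have hBcard : B.card ≤ 3 := by
    have h1 := Finset.card_insert_le z (insert (v z) (Y.filter fun y => v y = z))
    have h2 := Finset.card_insert_le (v z) (Y.filter fun y => v y = z)
    rw [hB]
    omega
  obtain ⟨Z, hZ, hcard, hfree⟩ := ih (Y \ B)
    (Finset.ssubset_iff_subset_ne.2 ⟨Finset.sdiff_subset, fun h => by
      have := h ▸ hz
      exact (Finset.mem_sdiff.1 this).2 hzB⟩)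
    (fun y hy => hv y (Finset.mem_sdiff.1 hy).1)
  have hZB : ∀ y ∈ Z, y ∈ Y ∧ y ∉ B := fun y hy => Finset.mem_sdiff.1 (hZ hy)
  have hzZ : z ∉ Z := fun h => (hZB z h).2 hzB
  refine ⟨insert z Z, Finset.insert_subset hz fun y hy => (hZB y hy).1, ?_, ?_⟩
  · rw [Finset.card_insert_of_notMem hzZ]
    have := Finset.le_card_sdiff B Y
    omega
  · intro y hy y' hy' h
    rcases Finset.mem_insert.1 hy with hyz | hy <;>
      rcases Finset.mem_insert.1 hy' with hyz' | hy'
    · exact hv z hz (by rw [hyz, hyz'] at h; exact h.symm)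
    · refine (hZB y' hy').2 ?_
      simp [hB, (hZB y' hy').1, h.symm.trans hyz]
    · refine (hZB y hy).2 ?_
      simp [hB, h, hyz']
    · exact hfree y hy y' hy' h

/-- Vertices with different `w` are joined through `r`; vertices sharing `w` are joined through that
vertex, with fresh third vertices supplied by large codegrees. The centre of a link thus varies,
which is why depth `0` is only a virtual root. -/
theorem level_one {α : Type*} [DecidableEq α] {E : Finset (Finset α)} {U : Finset α} {l : ℕ}
    (hE : ∀ e ∈ E, e.card = 3) (hEU : ∀ e ∈ E, e ⊆ U) {r : α} {L : Finset α} (hLne : L.Nonempty)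
    {w : α → α} (hedge : ∀ y ∈ L, ({r, w y, y} : Finset α) ∈ E)
    (hyw : ∀ y ∈ L, ∀ y' ∈ L, y ≠ w y')
    (hfat : ∀ y ∈ L, ∀ y' ∈ L, y ≠ y' → w y = w y' → 8 * l + 4 < codegree E {w y, y} ∧
      8 * l + 4 < codegree E {w y, y'}) :
    ∃ R anc, Level E U l 1 R L anc ∧ R.card ≤ 3 * L.card := by
  have hrL : ∀ y ∈ L, y ≠ r := fun y hy => (ne_of_mem hE (hedge y hy)).2.1.symm
  refine ⟨L ∪ insert r (L.image w), fun k x => if k = 0 then r else x, ⟨?_, ?_, ?_, ?_, ?_⟩, ?_⟩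
  · exact Finset.subset_union_left
  · intro z hz
    simp only [Finset.mem_union, Finset.mem_insert, Finset.mem_image] at hz
    rcases hz with hz | rfl | ⟨y, hy, rfl⟩
    · exact hEU _ (hedge z hz) (by simp)
    · obtain ⟨y, hy⟩ := hLne
      exact hEU _ (hedge y hy) (by simp)
    · exact hEU _ (hedge y hy) (by simp)
  · intro x _ y _
    simp
  · intro x _
    simp
  · intro j hj x hx x' hx' _ hne S hS hxS hxS' hSR
    obtain rfl : j = 0 := by omega
    simp only [zero_add, one_ne_zero, if_false] at hne
    have hrS : r ∉ S := fun h => hrL r (hSR r h (by simp)) rfl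
    have hwS : ∀ y ∈ L, w y ∉ S := fun y hy h =>
      hyw _ (hSR _ h (by simp only [Finset.mem_union, Finset.mem_insert, Finset.mem_image]
                         exact Or.inr (Or.inr ⟨y, hy, rfl⟩))) y hy rfl
    obtain ⟨h1, h2, h3⟩ := ne_of_mem hE (hedge x hx)
    obtain ⟨h1', h2', h3'⟩ := ne_of_mem hE (hedge x' hx')
    have hxw := hyw x hx x' hx'
    have hxw' := hyw x' hx' x hx
    by_cases hww : w x = w x'
    · obtain ⟨f1, f2⟩ := hfat x hx x' hx' hne hww
      obtain ⟨a, ha, haE⟩ := exists_third hE h3 (S := insert x' S) (by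
        have := Finset.card_insert_le x' S
        omega)
      obtain ⟨b, hb, hbE⟩ := exists_third hE (S := insert a (insert x S)) (hww ▸ h3') (by
        have := Finset.card_insert_le a (insert x S)
        have := Finset.card_insert_le x S
        omega)
      obtain ⟨-, a2, a3⟩ := ne_of_mem hE haE
      obtain ⟨b1, b2, b3⟩ := ne_of_mem hE hbE
      simp only [Finset.mem_insert, not_or] at ha hb
      refine ⟨[(a, w x), (b, x')], rfl, ⟨swap_right (swap_left haE), swap_right hbE, rfl⟩, ?_, ?_⟩
      · have q1 : x ≠ b := fun h => hb.2.1 h.symm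
        have q2 : a ≠ b := fun h => hb.1 h.symm
        simp [a3, h3.symm, q1, hne, a2.symm, q2, ha.1, b2, b1, b3.symm]
      · intro z hz
        simp only [verts_cons, verts_nil, List.mem_cons, List.not_mem_nil, or_false] at hz
        rcases hz with rfl | rfl | rfl | rfl
        · exact ha.2
        · exact hwS x hx
        · exact hb.2.2
        · exact hxS'
    · refine ⟨[(w x, r), (w x', x')], rfl, ⟨swap_left (swap_right (swap_left (hedge x hx))),
        hedge x' hx', rfl⟩, ?_, ?_⟩
      · simp [h3.symm, h2.symm, hxw, hne, h1.symm, hww, hxw'.symm, h1', h2', h3']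
      · intro z hz
        simp only [verts_cons, verts_nil, List.mem_cons, List.not_mem_nil, or_false] at hz
        rcases hz with rfl | rfl | rfl | rfl
        · exact hwS x hx
        · exact hrS
        · exact hwS x' hx'
        · exact hxS'
  · have h1 := Finset.card_union_le L (insert r (L.image w))
    have h2 := Finset.card_insert_le r (L.image w)
    have h3 : (L.image w).card ≤ L.card := Finset.card_image_le
    have h4 := hLne.card_pos
    omega

/-- Triples with the same `y` are charged to the same pair `{r, y}`, so the vertices `y` number at
least `|A| / (2l)`; a third of them survive the separation from their `v`. -/
theorem exists_level_one_of_fat {α : Type*} [DecidableEq α] {E : Finset (Finset α)}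
    {U : Finset α} {l : ℕ} (hE : ∀ e ∈ E, e.card = 3) (hEU : ∀ e ∈ E, e ⊆ U)
    {p : Finset α → Finset α} (hp : ∀ q, (E.filter fun e => p e = q).card ≤ 2 * l) {r : α}
    {A : Finset (Finset α)} (hA : A ⊆ E) (hAne : A.Nonempty)
    (h : ∀ e ∈ A, ∃ v y, e = {r, v, y} ∧ p e = {r, y} ∧ 8 * l + 4 < codegree E {v, y}) :
    ∃ R L anc, Level E U l 1 R L anc ∧ R.card ≤ 3 * L.card ∧ A.card ≤ 6 * l * L.card := by
  classical
  have : Nonempty α := ⟨r⟩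
  choose! vf yf he hpe hfat using h
  have hcard : A.card ≤ 2 * l * (A.image yf).card := by
    refine Finset.card_le_mul_card_image A (2 * l) fun y hy => ?_
    refine (Finset.card_le_card fun e hm => ?_).trans (hp {r, y})
    rw [Finset.mem_filter] at hm ⊢
    exact ⟨hA hm.1, by rw [hpe e hm.1, hm.2]⟩
  have hex : ∀ y ∈ A.image yf, ∃ v, ({r, v, y} : Finset α) ∈ E ∧
      8 * l + 4 < codegree E {v, y} := by
    intro y hy
    obtain ⟨e, hm, rfl⟩ := Finset.mem_image.1 hy
    exact ⟨vf e, he e hm ▸ hA hm, hfat e hm⟩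
  choose! v hvE hvfat using hex
  obtain ⟨L, hL, hLcard, hfree⟩ := exists_free_subset v (A.image yf)
    fun y hy => (ne_of_mem hE (hvE y hy)).2.2
  have hLne : L.Nonempty := by
    rw [← Finset.card_pos]
    have := (hAne.image yf).card_pos
    omega
  obtain ⟨R, anc, hlev, hR⟩ := level_one (l := l) hE hEU hLne (fun y hy => hvE y (hL hy)) hfree
    (fun y hy y' hy' _ hww => ⟨hvfat y (hL hy), hww ▸ hvfat y' (hL hy')⟩)
  refine ⟨R, L, anc, hlev, hR, hcard.trans ?_⟩
  calc 2 * l * (A.image yf).card ≤ 2 * l * (3 * L.card) := Nat.mul_le_mul_left _ hLcard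
    _ = _ := by ring

/-- Every `z ≠ r` lies in few triples of `A`: either `{r, z}` has small codegree, or `z` can only
play the role of `x` and the charging bound applies. Hence a maximal family of triples disjoint
outside `r` is large. -/
theorem exists_level_one_of_thin {α : Type*} [DecidableEq α] {E : Finset (Finset α)}
    {U : Finset α} {l : ℕ} (hE : ∀ e ∈ E, e.card = 3) (hEU : ∀ e ∈ E, e ⊆ U)
    {p : Finset α → Finset α} (hp : ∀ q, (E.filter fun e => p e = q).card ≤ 2 * l) {r : α}
    {A : Finset (Finset α)} (hA : A ⊆ E) (hAne : A.Nonempty)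
    (h : ∀ e ∈ A, ∃ v x, e = {r, v, x} ∧ p e = {r, x} ∧ codegree E {r, v} ≤ 8 * l + 4) :
    ∃ R L anc, Level E U l 1 R L anc ∧ R.card ≤ 3 * L.card ∧
      A.card ≤ 2 * (8 * l + 4) * L.card := by
  classical
  have : Nonempty α := ⟨r⟩
  have hdeg : ∀ z ≠ r, (A.filter fun e => z ∈ e).card ≤ 8 * l + 4 := by
    intro z hz
    by_cases hfat : codegree E {r, z} ≤ 8 * l + 4
    · refine (Finset.card_le_card fun e hm => ?_).trans hfat
      rw [Finset.mem_filter] at hm ⊢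
      refine ⟨hA hm.1, ?_⟩
      obtain ⟨v, x, rfl, -⟩ := h e hm.1
      exact Finset.insert_subset (by simp) (Finset.singleton_subset_iff.2 hm.2)
    · refine (Finset.card_le_card fun e hm => ?_).trans ((hp {r, z}).trans (by omega))
      rw [Finset.mem_filter] at hm ⊢
      refine ⟨hA hm.1, ?_⟩
      obtain ⟨v, x, rfl, h2, h3⟩ := h e hm.1
      have hzm := hm.2
      simp only [Finset.mem_insert, Finset.mem_singleton] at hzm
      rcases hzm with h' | rfl | rfl
      · exact absurd h' hz
      · exact absurd h3 hfat
      · exact h2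
  obtain ⟨M, hM, hMmax⟩ := Finset.exists_max_image
    (A.powerset.filter fun M => ∀ e ∈ M, ∀ e' ∈ M, ∀ z, z ≠ r → z ∈ e → z ∈ e' → e = e')
    Finset.card ⟨∅, by simp⟩
  rw [Finset.mem_filter, Finset.mem_powerset] at hM
  obtain ⟨hMA, hMd⟩ := hM
  have hmeet : ∀ e ∈ A, ∃ e' ∈ M, ∃ z, z ≠ r ∧ z ∈ e ∧ z ∈ e' := by
    intro e he
    by_contra! hcon
    have heM : e ∉ M := by
      intro heM
      obtain ⟨v, x, hvx, -⟩ := h e he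
      have hne := ne_of_mem hE (hvx ▸ hA he)
      have hv : v ∈ e := by simp [hvx]
      exact hcon e heM v hne.1.symm hv hv
    have := hMmax (insert e M) (by
      rw [Finset.mem_filter, Finset.mem_powerset]
      refine ⟨Finset.insert_subset he hMA, ?_⟩
      intro a ha b hb z hz hza hzb
      rcases Finset.mem_insert.1 ha with hae | ha <;>
        rcases Finset.mem_insert.1 hb with hbe | hb
      · rw [hae, hbe]
      · exact absurd hzb (hcon b hb z hz (hae ▸ hza))
      · exact absurd hza (hcon a ha z hz (hbe ▸ hzb))
      · exact hMd a ha b hb z hz hza hzb)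
    rw [Finset.card_insert_of_notMem heM] at this
    omega
  choose! wf yf hf using fun e (he : e ∈ A) => (h e he).imp fun v h => h.imp fun x h => h.1
  have hfM : ∀ e ∈ M, e = {r, wf e, yf e} := fun e he => hf e (hMA he)
  have hne : ∀ e ∈ M, r ≠ wf e ∧ r ≠ yf e ∧ wf e ≠ yf e := fun e he =>
    ne_of_mem hE (hfM e he ▸ hA (hMA he))
  have hw_mem : ∀ e ∈ M, wf e ∈ e := fun e he => by
    have : wf e ∈ ({r, wf e, yf e} : Finset α) := by simp
    rwa [← hfM e he] at this
  have hy_mem : ∀ e ∈ M, yf e ∈ e := fun e he => by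
    have : yf e ∈ ({r, wf e, yf e} : Finset α) := by simp
    rwa [← hfM e he] at this
  have hinj : ∀ e ∈ M, ∀ e' ∈ M, yf e = yf e' → e = e' := fun e he e' he' hy =>
    hMd e he e' he' (yf e) (hne e he).2.1.symm (hy_mem e he) (hy ▸ hy_mem e' he')
  have hLM : (M.image yf).card = M.card :=
    Finset.card_image_of_injOn fun e he e' he' hy => hinj e he e' he' hy
  have hAM : A.card ≤ 2 * (8 * l + 4) * M.card := by
    have hsub : A ⊆ M.biUnion fun e' => (e'.erase r).biUnion fun z => A.filter fun e => z ∈ e := by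
      intro e he
      obtain ⟨e', he', z, hz, hze, hze'⟩ := hmeet e he
      simp only [Finset.mem_biUnion, Finset.mem_erase, Finset.mem_filter]
      exact ⟨e', he', z, ⟨hz, hze'⟩, he, hze⟩
    refine (Finset.card_le_card hsub).trans ?_
    rw [mul_comm]
    refine Finset.card_biUnion_le_card_mul _ _ _ fun e' he' => ?_
    have h2 : (e'.erase r).card = 2 := by
      have hr : r ∈ e' := by
        have : r ∈ ({r, wf e', yf e'} : Finset α) := by simp
        rwa [← hfM e' he'] at this
      rw [Finset.card_erase_of_mem hr, hE e' (hA (hMA he'))]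
    have := Finset.card_biUnion_le_card_mul (e'.erase r) (fun z => A.filter fun e => z ∈ e)
      (8 * l + 4) fun z hz => hdeg z (Finset.mem_erase.1 hz).1
    rwa [h2] at this
  have hex : ∀ y ∈ M.image yf, ∃ e ∈ M, yf e = y := fun y hy => Finset.mem_image.1 hy
  choose! s hs hsy using hex
  have hMne : M.Nonempty := by
    obtain ⟨e, he⟩ := hAne
    obtain ⟨e', he', -⟩ := hmeet e he
    exact ⟨e', he'⟩
  obtain ⟨R, anc, hlev, hR⟩ := level_one (l := l) (r := r) (L := M.image yf)
    (w := fun y => wf (s y)) hE hEU (hMne.image yf)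
    (by
      intro y hy
      have h1 := hA (hMA (hs y hy))
      rw [hfM _ (hs y hy), hsy y hy] at h1
      exact h1)
    (by
      intro y hy y' hy' hyy
      have h1 : s y = s y' := hMd _ (hs y hy) _ (hs y' hy') y
        (by rw [← hsy y hy]; exact (hne _ (hs y hy)).2.1.symm)
        (by have := hy_mem _ (hs y hy); rwa [hsy y hy] at this)
        (by rw [hyy]; exact hw_mem _ (hs y' hy'))
      refine (hne _ (hs y hy)).2.2 ?_
      rw [hsy y hy, h1]
      exact hyy.symm)
    (by
      intro y hy y' hy' hyy hww
      refine absurd ?_ hyy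
      have h1 : s y = s y' := hMd _ (hs y hy) _ (hs y' hy') (wf (s y))
        (hne _ (hs y hy)).1.symm (hw_mem _ (hs y hy)) (by
          have : wf (s y) = wf (s y') := hww
          rw [this]; exact hw_mem _ (hs y' hy'))
      rw [← hsy y hy, ← hsy y' hy', h1])
  exact ⟨R, M.image yf, anc, hlev, hR, by rw [hLM]; exact hAM⟩

theorem exists_level_one {α : Type*} [DecidableEq α] {E : Finset (Finset α)} {U : Finset α}
    {l D : ℕ} (hl : 3 ≤ l) (hE : ∀ e ∈ E, e.card = 3) (hEU : ∀ e ∈ E, e ⊆ U)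
    (hfree : CycleFree E l) (hD : D ^ 2 * U.card < 2 * E.card) :
    ∃ R L anc, Level E U l 1 R L anc ∧ R.card ≤ 3 * L.card ∧ 0 < L.card ∧
      D ^ 2 ≤ 80 * l * L.card := by
  classical
  obtain ⟨p, hp, hpq⟩ := exists_charging hl E hE hfree
  let A : α → Finset (Finset α) := fun r => E.filter fun e =>
    ∃ v y, e = {r, v, y} ∧ p e = {r, y} ∧ 8 * l + 4 < codegree E {v, y}
  let N : α → Finset (Finset α) := fun r => E.filter fun e =>
    ∃ v x, e = {r, v, x} ∧ p e = {r, x} ∧ codegree E {r, v} ≤ 8 * l + 4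
  have hcover : E ⊆ U.biUnion fun r => A r ∪ N r := by
    intro e he
    obtain ⟨hpe, hpc⟩ := hp e he
    obtain ⟨x, y, hxy, hpxy⟩ := Finset.card_eq_two.1 hpc
    obtain ⟨v, rfl⟩ := eq_triple_of_pair_subset (hE e he) hxy (hpxy ▸ hpe)
    have e1 : ({x, y, v} : Finset α) = {x, v, y} := by rw [Finset.pair_comm]
    simp only [Finset.mem_biUnion, Finset.mem_union, A, N, Finset.mem_filter]
    -- For a triple charged to `{x, y}` with third vertex `v`, the codegree of `{v, y}` decides
    -- which end becomes the root: `x` if it is large, `y` if not.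
    by_cases hf : 8 * l + 4 < codegree E {v, y}
    · exact ⟨x, hEU _ he (by simp), Or.inl ⟨he, v, y, e1, hpxy, hf⟩⟩
    · refine ⟨y, hEU _ he (by simp), Or.inr ⟨he, v, x, ?_, ?_, ?_⟩⟩
      · rw [Finset.insert_comm, Finset.pair_comm]
      · rw [hpxy, Finset.pair_comm]
      · rw [Finset.pair_comm]; exact not_lt.1 hf
  have hsum : E.card ≤ ∑ r ∈ U, ((A r).card + (N r).card) :=
    (Finset.card_le_card hcover).trans (Finset.card_biUnion_le.trans
      (Finset.sum_le_sum fun r _ => Finset.card_union_le _ _))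
  obtain ⟨r, hr, hrD⟩ : ∃ r ∈ U, D ^ 2 < 2 * ((A r).card + (N r).card) := by
    by_contra! hcon
    have := Finset.sum_le_sum hcon
    rw [← Finset.mul_sum, Finset.sum_const, smul_eq_mul] at this
    nlinarith
  rcases le_total (N r).card (A r).card with hAN | hAN
  · obtain ⟨R, L, anc, hlev, hR, hc⟩ := exists_level_one_of_fat hE hEU hpq (A := A r)
      (Finset.filter_subset _ _) (Finset.card_pos.1 (by omega))
      (fun e he => (Finset.mem_filter.1 he).2)
    refine ⟨R, L, anc, hlev, hR, Nat.pos_of_ne_zero fun h => ?_, ?_⟩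
    · rw [h] at hc; omega
    · nlinarith
  · obtain ⟨R, L, anc, hlev, hR, hc⟩ := exists_level_one_of_thin hE hEU hpq (A := N r)
      (Finset.filter_subset _ _) (Finset.card_pos.1 (by omega))
      (fun e he => (Finset.mem_filter.1 he).2)
    refine ⟨R, L, anc, hlev, hR, Nat.pos_of_ne_zero fun h => ?_, ?_⟩
    · rw [h] at hc; omega
    · nlinarith

/-! ### Deletion -/

/-- Choose a largest `S` that is isolated by deleting some `T` with `|T| ≤ D * |S|`. If `T` covers
half of `V`, then `S` is the independent set. If not, `V \ T` expands, since a violating pair could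
be adjoined to `(S, T)`. -/
theorem exists_indep_or_expands {α : Type*} [LinearOrder α] {V : Finset α}
    {E : Finset (Finset α)} (hE : ∀ e ∈ E, e.card = 3) (D : ℕ) :
    (∃ S ⊆ V, Indep E S ∧ V.card ≤ 2 * D * S.card) ∨
      ∃ U ⊆ V, V.card ≤ 2 * U.card ∧ Expands (E.filter fun e => e ⊆ U) U D := by
  classical
  obtain ⟨⟨S, T⟩, hST, hmax⟩ := Finset.exists_max_image
    ((V.powerset ×ˢ V.powerset).filter fun q : Finset α × Finset α => q.1 ⊆ q.2 ∧
      q.2.card ≤ D * q.1.card ∧ ∀ e ∈ E, e ⊆ q.1 ∪ (V \ q.2) → Disjoint e q.1)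
    (fun q => q.1.card) ⟨(∅, ∅), by simp⟩
  simp only [Finset.mem_filter, Finset.mem_product, Finset.mem_powerset] at hST hmax
  obtain ⟨⟨hSV, hTV⟩, hS, hcard, hdisj⟩ := hST
  have hT : (V \ T).card + T.card = V.card := Finset.card_sdiff_add_card_eq_card hTV
  by_cases hhalf : V.card ≤ 2 * T.card
  · refine Or.inl ⟨S, hSV, fun e he hsub => ?_, by nlinarith⟩
    have h1 := hdisj e he (hsub.trans Finset.subset_union_left)
    have h2 : e = ∅ := Finset.disjoint_self_iff_empty e |>.1 (h1.mono_right hsub)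
    have := hE e he
    rw [h2] at this
    simp at this
  · refine Or.inr ⟨V \ T, Finset.sdiff_subset, by omega, ?_⟩
    intro X hX hXne T' hT' hXT' hT'card
    by_contra! hcon
    have hXS : Disjoint S X := by
      rw [Finset.disjoint_left]
      intro x hx hx'
      exact (Finset.mem_sdiff.1 (hX hx')).2 (hS hx)
    have := hmax (S ∪ X, T ∪ T') ⟨⟨Finset.union_subset hSV (hX.trans Finset.sdiff_subset),
      Finset.union_subset hTV (hT'.trans Finset.sdiff_subset)⟩,
      Finset.union_subset_union hS hXT', ?_, ?_⟩
    · rw [Finset.card_union_of_disjoint hXS] at this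
      have := hXne.card_pos
      omega
    · rw [Finset.card_union_of_disjoint hXS, mul_add]
      exact (Finset.card_union_le _ _).trans (Nat.add_le_add hcard hT'card)
    · intro e he hsub
      have hsub' : ∀ z ∈ e, z ∈ S ∨ z ∈ X ∨ (z ∈ V ∧ z ∉ T ∧ z ∉ T') := by
        intro z hz
        have := hsub hz
        simp only [Finset.mem_union, Finset.mem_sdiff, not_or] at this
        tauto
      have h1 : Disjoint e S := by
        refine hdisj e he fun z hz => ?_
        rw [Finset.mem_union]
        rcases hsub' z hz with h | h | h
        · exact Or.inl h
        · exact Or.inr (hX h)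
        · exact Or.inr (Finset.mem_sdiff.2 ⟨h.1, h.2.1⟩)
      have h2 : ∀ z ∈ e, z ∈ X ∨ (z ∈ V \ T ∧ z ∉ T') := by
        intro z hz
        rcases hsub' z hz with h | h | h
        · exact absurd h (Finset.disjoint_left.1 h1 hz)
        · exact Or.inl h
        · exact Or.inr ⟨Finset.mem_sdiff.2 ⟨h.1, h.2.1⟩, h.2.2⟩
      rw [Finset.disjoint_union_right]
      refine ⟨h1, Finset.disjoint_left.2 fun z hz hzX => ?_⟩
      refine hcon e (Finset.mem_filter.2 ⟨he, fun z hz => ?_⟩) (fun z hz => ?_) z hz hzX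
      · rcases h2 z hz with h | h
        · exact hX h
        · exact h.1
      · rw [Finset.mem_union, Finset.mem_sdiff]
        exact h2 z hz

/-! ### Growing the forest -/

theorem exists_level {l : ℕ} (hl : 3 ≤ l) (i : ℕ) (hi : 2 * i < l) :
    ∃ K : ℕ, ∀ (α : Type u) [LinearOrder α] (E : Finset (Finset α)) (U : Finset α) (D : ℕ),
      (∀ e ∈ E, e.card = 3) → (∀ e ∈ E, e ⊆ U) → CycleFree E l → Expands E U D →
      D ^ 2 * U.card < 2 * E.card → K ≤ D →
      ∃ R L anc, Level E U l (i + 1) R L anc ∧ R.card ≤ K * L.card ∧ 0 < L.card ∧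
        D ^ (i + 2) ≤ K * L.card := by
  induction i with
  | zero =>
    refine ⟨80 * l, fun α _ E U D hE hEU hfree _ hD _ => ?_⟩
    obtain ⟨R, L, anc, hlev, hR, hpos, hc⟩ := exists_level_one hl hE hEU hfree hD
    exact ⟨R, L, anc, hlev, hR.trans (Nat.mul_le_mul_right _ (by omega)), hpos, hc⟩
  | succ i ih =>
    obtain ⟨K, hK⟩ := ih (by omega)
    obtain ⟨B, hB⟩ : ∃ B, B = K * l ^ (i + 1) + l * (i + 1) * l ^ (i + 1) := ⟨_, rfl⟩
    -- The summands serve in turn the induction hypothesis, the growth of the level, the size of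
    -- `R`, and `2 * B ≤ D`, by which the used vertices and tips absorb at most half of the
    -- expansion.
    refine ⟨K + 4 * K * l ^ (i + 1) + 6 + 2 * B,
      fun α _ E U D hE hEU hfree hexp hD hKD => ?_⟩
    obtain ⟨R, L, anc, hlev, hR, hpos, hc⟩ := hK α E U D hE hEU hfree hexp hD (by
      have : 0 ≤ 4 * K * l ^ (i + 1) := Nat.zero_le _
      omega)
    obtain ⟨X, hXL, hLX, hXind, htips⟩ := hlev.exists_indep hE hfree hi
    have hXpos : 0 < X.card := by
      rcases Nat.eq_zero_or_pos X.card with h | h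
      · rw [h] at hLX; omega
      · exact h
    obtain ⟨L', π, w, h1, h2, h3, h4, h5, h6, h7⟩ := exists_disjoint_family hE hexp
      hlev.subset_univ (hXL.trans hlev.subset) (Finset.card_pos.1 hXpos) hXind
    have hRX : R.card ≤ K * l ^ (i + 1) * X.card := by
      calc R.card ≤ K * L.card := hR
        _ ≤ K * (l ^ (i + 1) * X.card) := Nat.mul_le_mul_left _ hLX
        _ = _ := by ring
    have h8 : D * X.card < B * X.card + 2 * L'.card := by
      rw [hB, add_mul]
      omega
    have h9 : 2 * (B * X.card) ≤ D * X.card := by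
      rw [← mul_assoc]
      refine Nat.mul_le_mul_right _ ?_
      have : 0 ≤ 4 * K * l ^ (i + 1) := Nat.zero_le _
      omega
    have h10 : D * X.card ≤ 4 * L'.card := by omega
    have hBR : R.card ≤ B * X.card := by
      rw [hB, add_mul]; omega
    refine ⟨_, L', _, hlev.succ hE h1 h2 (fun y hy => hXL (h3 y hy)) h4 h5 h6, ?_, by omega, ?_⟩
    · have c1 := Finset.card_union_le (R ∪ L') (L'.image w)
      have c2 := Finset.card_union_le R L'
      have c3 : (L'.image w).card ≤ L'.card := Finset.card_image_le
      calc _ ≤ 6 * L'.card := by omega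
        _ ≤ _ := Nat.mul_le_mul_right _ (by omega)
    · calc D ^ (i + 1 + 2) = D * D ^ (i + 2) := by ring
        _ ≤ D * (K * (l ^ (i + 1) * X.card)) :=
          Nat.mul_le_mul_left _ (hc.trans (Nat.mul_le_mul_left _ hLX))
        _ = K * l ^ (i + 1) * (D * X.card) := by ring
        _ ≤ K * l ^ (i + 1) * (4 * L'.card) := Nat.mul_le_mul_left _ h10
        _ = 4 * K * l ^ (i + 1) * L'.card := by ring
        _ ≤ _ := Nat.mul_le_mul_right _ (by omega)

theorem exists_indep_of_cycleFree {l m : ℕ} (hl : 3 ≤ l) (hm : 2 * (m + 1) < l) :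
    ∃ C : ℕ, ∀ (α : Type u) [LinearOrder α] (E : Finset (Finset α)) (V : Finset α) (D : ℕ),
      (∀ e ∈ E, e.card = 3) → CycleFree E l → 0 < D → C ≤ D →
      ∃ S ⊆ V, Indep E S ∧ (V.card ≤ 4 * D * S.card ∨ D ^ (m + 2) ≤ C * S.card) := by
  obtain ⟨K, hK⟩ := exists_level.{u} hl m (by omega)
  have hKle : K ≤ K * l ^ (m + 1) := Nat.le_mul_of_pos_right _ (by positivity)
  refine ⟨K * l ^ (m + 1), fun α _ E V D hE hfree hDpos hCD => ?_⟩
  rcases exists_indep_or_expands (V := V) hE D with ⟨S, hS, hind, hc⟩ | ⟨U, hU, hUV, hexp⟩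
  · exact ⟨S, hS, hind, Or.inl (hc.trans (Nat.mul_le_mul_right _ (by omega)))⟩
  have hsub : (E.filter fun e => e ⊆ U) ⊆ E := Finset.filter_subset _ _
  have hE' : ∀ e ∈ E.filter fun e => e ⊆ U, e.card = 3 := fun e he => hE e (hsub he)
  have hEU : ∀ e ∈ E.filter fun e => e ⊆ U, e ⊆ U := fun e he => (Finset.mem_filter.1 he).2
  have hind' : ∀ S ⊆ U, Indep (E.filter fun e => e ⊆ U) S → Indep E S := fun S hS h e he hes =>
    h e (Finset.mem_filter.2 ⟨he, hes.trans hS⟩) hes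
  by_cases hD : D ^ 2 * U.card < 2 * (E.filter fun e => e ⊆ U).card
  · obtain ⟨R, L, anc, hlev, -, -, hc⟩ := hK α _ U D hE' hEU (hfree.subset hsub) hexp hD
      (by omega)
    obtain ⟨X, hXL, hLX, hXind, -⟩ := hlev.exists_indep hE' (hfree.subset hsub) hm
    have hXU : X ⊆ U := hXL.trans (hlev.subset.trans hlev.subset_univ)
    refine ⟨X, hXU.trans hU, hind' X hXU hXind, Or.inr ?_⟩
    calc D ^ (m + 2) ≤ K * L.card := hc
      _ ≤ K * (l ^ (m + 1) * X.card) := Nat.mul_le_mul_left _ hLX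
      _ = _ := by ring
  · obtain ⟨S, hS, hind, hc⟩ := exists_indep_of_card_le hE' hEU hDpos (not_lt.1 hD)
    refine ⟨S, hS.trans hU, hind' S hS hind, Or.inl ?_⟩
    calc V.card ≤ 2 * U.card := hUV
      _ ≤ 2 * (2 * D * S.card) := Nat.mul_le_mul_left _ hc
      _ = _ := by ring

end TripleSystem

/-! ### Hypergraphs and Ramsey numbers -/

namespace Hypergraph

theorem exists_isIndependent_le (l m : ℕ) (hl : 3 ≤ l) (hm : m = (l - 1) / 2) :
    ∃ c : ℝ, 0 < c ∧ ∀ (α : Type u) (H : Hypergraph α), H.vertexSet.Finite → H.IsUniform 3 →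
      ¬ H.ContainsLooseCycle l 3 → ∃ s : Set α, H.IsIndependent s ∧
        c * (H.vertexSet.ncard : ℝ) ^ (((m : ℝ) + 1) / ((m : ℝ) + 2)) ≤ (s.ncard : ℝ) := by
  obtain ⟨k, rfl⟩ : ∃ k, m = k + 1 := ⟨m - 1, by omega⟩
  obtain ⟨C, hC⟩ := TripleSystem.exists_indep_of_cycleFree.{u} (l := l) (m := k) hl (by omega)
  -- The three terms cover the case `D < C`, where a single vertex suffices, and the two
  -- alternatives of `hC`.
  obtain ⟨B, hB⟩ : ∃ B : ℝ, B = (C + 2) ^ (k + 2) + 4 + 2 ^ (k + 2) * C := ⟨_, rfl⟩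
  have hB1 : (0 : ℝ) ≤ (C + 2) ^ (k + 2) := by positivity
  have hB2 : (0 : ℝ) ≤ 2 ^ (k + 2) * C := by positivity
  have hBpos : 0 < B := by linarith
  refine ⟨1 / B, by positivity, fun α H hfin hunif hfree => ?_⟩
  classical
  -- Any order will do; it only makes branches comparable.
  let _ : LinearOrder α := linearOrderOfSTO WellOrderingRel
  obtain ⟨V, hV⟩ : ∃ V : Finset α, (V : Set α) = H.vertexSet := ⟨hfin.toFinset, by simp⟩
  let E : Finset (Finset α) := V.powerset.filter fun e => (e : Set α) ∈ H.edgeSet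
  have hEmem : ∀ e, e ∈ E ↔ (e : Set α) ∈ H.edgeSet := by
    intro e
    simp only [E, Finset.mem_filter, Finset.mem_powerset, and_iff_right_iff_imp]
    intro he
    rw [← Finset.coe_subset, hV]
    exact H.subset_vertexSet_of_mem_edgeSet' he
  have hE : ∀ e ∈ E, e.card = 3 := by
    intro e he
    have := hunif _ ((hEmem e).1 he)
    rw [Set.encard_coe_eq_coe_finsetCard] at this
    exact_mod_cast this
  have hcyc : TripleSystem.CycleFree E l := by
    intro a P hP hlen hnd
    obtain ⟨e, he, het⟩ := TripleSystem.exists_isLooseCycle_of_walk hl hP hlen hnd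
    refine hfree ⟨e, he, fun i => ?_⟩
    obtain ⟨t, ht, hti⟩ := het i
    rw [hti]
    exact ⟨(hEmem t).1 ht, hunif _ ((hEmem t).1 ht)⟩
  have hcard : H.vertexSet.ncard = V.card := by rw [← hV, Set.ncard_coe_finset]
  suffices h : ∃ S ⊆ V, TripleSystem.Indep E S ∧
      (V.card : ℝ) ^ (((k + 1 : ℕ) + 1 : ℝ) / ((k + 1 : ℕ) + 2)) ≤ B * S.card by
    obtain ⟨S, hSV, hind, hle⟩ := h
    refine ⟨S, ⟨hV ▸ Finset.coe_subset.2 hSV, fun e he hes => ?_⟩, ?_⟩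
    · have hfe : e.Finite := S.finite_toSet.subset hes
      refine hind hfe.toFinset ((hEmem _).2 (by simpa using he)) ?_
      rw [← Finset.coe_subset]
      simpa using hes
    · rw [hcard, Set.ncard_coe_finset, one_div, inv_mul_le_iff₀ hBpos]
      exact hle
  rcases V.eq_empty_or_nonempty with rfl | ⟨v, hv⟩
  · refine ⟨∅, subset_rfl, fun e he hes => ?_, ?_⟩
    · have := hE e he
      rw [Finset.subset_empty.1 hes] at this
      simp at this
    · have hne : (((k + 1 : ℕ) + 1 : ℝ) / ((k + 1 : ℕ) + 2)) ≠ 0 := by positivity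
      rw [Finset.card_empty, Nat.cast_zero, Real.zero_rpow hne, mul_zero]
  have hn : (1 : ℝ) ≤ V.card := by
    exact_mod_cast Finset.card_pos.2 ⟨v, hv⟩
  obtain ⟨x, hx⟩ : ∃ x : ℝ, x = (V.card : ℝ) ^ (1 / ((k : ℝ) + 3)) := ⟨_, rfl⟩
  have hx1 : 1 ≤ x := by
    rw [hx]; exact Real.one_le_rpow hn (by positivity)
  have hpow : ∀ j : ℕ, x ^ j = (V.card : ℝ) ^ ((j : ℝ) / ((k : ℝ) + 3)) := by
    intro j
    rw [hx, ← Real.rpow_natCast, ← Real.rpow_mul (by positivity)]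
    congr 1
    ring
  have hxn : x ^ (k + 3) = V.card := by
    rw [hpow]
    push_cast
    rw [div_self (by positivity), Real.rpow_one]
  have hgoal : (V.card : ℝ) ^ (((k + 1 : ℕ) + 1 : ℝ) / ((k + 1 : ℕ) + 2)) = x ^ (k + 2) := by
    rw [hpow]
    congr 1
    push_cast
    ring
  rw [hgoal]
  -- With `x = |V|^(1/(k+3))` the bounds `|V| / D` and `D^(k+2)` balance; rounding costs at most a
  -- factor `2` in `D`.
  obtain ⟨D, hD⟩ : ∃ D, D = ⌊x⌋₊ := ⟨_, rfl⟩
  have hDx : (D : ℝ) ≤ x := hD ▸ Nat.floor_le (by linarith)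
  have hxD : x < D + 1 := hD ▸ Nat.lt_floor_add_one x
  have hDpos : 0 < D := hD ▸ Nat.floor_pos.2 hx1
  have hD1 : (1 : ℝ) ≤ D := by exact_mod_cast hDpos
  by_cases hCD : C ≤ D
  · obtain ⟨S, hS, hind, h | h⟩ := hC α E V D hE hcyc hDpos hCD
    · refine ⟨S, hS, hind, ?_⟩
      have h' : (V.card : ℝ) ≤ 4 * D * S.card := by exact_mod_cast h
      have h1 : x * x ^ (k + 2) ≤ x * (4 * S.card) := by
        calc x * x ^ (k + 2) = x ^ (k + 3) := by ring
          _ ≤ 4 * D * S.card := by rw [hxn]; exact h'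
          _ ≤ 4 * x * S.card := by gcongr
          _ = _ := by ring
      refine (le_of_mul_le_mul_left h1 (by linarith)).trans ?_
      gcongr
      linarith
    · refine ⟨S, hS, hind, ?_⟩
      have h' : (D : ℝ) ^ (k + 2) ≤ C * S.card := by exact_mod_cast h
      calc x ^ (k + 2) ≤ (2 * D) ^ (k + 2) := by gcongr; linarith
        _ = 2 ^ (k + 2) * D ^ (k + 2) := by rw [mul_pow]
        _ ≤ 2 ^ (k + 2) * (C * S.card) := by gcongr
        _ = 2 ^ (k + 2) * C * S.card := by ring
        _ ≤ B * S.card := by gcongr; linarith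
  · refine ⟨{v}, by simpa using hv, fun e he hes => ?_, ?_⟩
    · have h1 := Finset.card_le_card hes
      rw [hE e he] at h1
      simp at h1
    · have h1 : (D : ℝ) ≤ C := by exact_mod_cast (not_le.1 hCD).le
      calc x ^ (k + 2) ≤ (C + 2) ^ (k + 2) := by gcongr; linarith
        _ ≤ B * (({v} : Finset α).card : ℝ) := by simp; linarith

/-- An independent set of the red hypergraph spans only blue triples. -/
theorem ramseyProperty_of_le {l n N : ℕ} {c e : ℝ}
    (h : ∀ (α : Type) (H : Hypergraph α), H.vertexSet.Finite → H.IsUniform 3 →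
      ¬ H.ContainsLooseCycle l 3 → ∃ s : Set α, H.IsIndependent s ∧
        c * (H.vertexSet.ncard : ℝ) ^ e ≤ (s.ncard : ℝ))
    (hN : (n : ℝ) ≤ c * (N : ℝ) ^ e) : RamseyProperty l n 3 N := by
  intro col
  by_cases hred : ((uniformClique N 3).colourClass col true).ContainsLooseCycle l 3
  · exact Or.inl hred
  right
  have hvs : ((uniformClique N 3).colourClass col true).vertexSet = Set.univ := rfl
  obtain ⟨s, ⟨-, hs⟩, hle⟩ := h (Fin N) ((uniformClique N 3).colourClass col true)
    (Set.toFinite _) (fun e he => he.1) hred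
  rw [hvs, Set.ncard_univ, Nat.card_fin] at hle
  have hns : n ≤ s.ncard := by exact_mod_cast hN.trans hle
  obtain ⟨t, hts, htn⟩ := Set.exists_subset_card_eq hns
  refine ⟨t, Set.subset_univ _, ?_, fun e he hcard => ?_⟩
  · rw [← htn, Set.Finite.cast_ncard_eq (Set.toFinite t)]
  · refine ⟨hcard, ?_⟩
    by_contra hcol
    rw [Bool.not_eq_false] at hcol
    exact hs e ⟨hcard, hcol⟩ (he.trans hts)

theorem exists_isRamseyNumber_le (l : ℕ) (hl : 3 ≤ l) :
    ∃ c : ℝ, ∀ n : ℕ, ∃ R : ℕ, IsRamseyNumber l n 3 R ∧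
      (R : ℝ) ≤ c * (n : ℝ) ^ (1 + 1 / (((l + 1) / 2 : ℕ) : ℝ)) := by
  obtain ⟨m, hm⟩ : ∃ m, m = (l - 1) / 2 := ⟨_, rfl⟩
  have hlm : (l + 1) / 2 = m + 1 := by omega
  obtain ⟨c, hc, h⟩ := exists_isIndependent_le.{0} l m hl hm
  obtain ⟨d, hd⟩ : ∃ d : ℝ, d = ((m : ℝ) + 2) / (m + 1) := ⟨_, rfl⟩
  have hdpos : 0 < d := by rw [hd]; positivity
  have hexp : (1 + 1 / (((l + 1) / 2 : ℕ) : ℝ)) = d := by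
    rw [hlm, hd]; push_cast; field_simp; ring
  rw [hexp]
  have key : ∀ n : ℕ, ∃ N : ℕ, RamseyProperty l n 3 N ∧
      (N : ℝ) ≤ ((1 / c) ^ d + 1) * (n : ℝ) ^ d := by
    intro n
    rcases Nat.eq_zero_or_pos n with rfl | hn
    · refine ⟨0, ramseyProperty_of_le h ?_, ?_⟩
      · have : ((m : ℝ) + 1) / (m + 2) ≠ 0 := by positivity
        simp [Real.zero_rpow this]
      · simp [Real.zero_rpow hdpos.ne']
    · have hn1 : (1 : ℝ) ≤ n := by exact_mod_cast hn
      have hle : ((n : ℝ) / c) ^ d ≤ ⌈((n : ℝ) / c) ^ d⌉₊ := Nat.le_ceil _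
      refine ⟨⌈((n : ℝ) / c) ^ d⌉₊, ramseyProperty_of_le h ?_, ?_⟩
      · have h1 : (n : ℝ) / c = (((n : ℝ) / c) ^ d) ^ (((m : ℝ) + 1) / (m + 2)) := by
          rw [← Real.rpow_mul (by positivity), hd, div_mul_div_cancel₀' (by positivity),
            div_self (by positivity), Real.rpow_one]
        rw [← div_le_iff₀' hc]
        refine h1.le.trans ?_
        exact Real.rpow_le_rpow (by positivity) hle (by positivity)
      · have h2 : (1 : ℝ) ≤ (n : ℝ) ^ d := Real.one_le_rpow hn1 hdpos.le
        have h3 : ((n : ℝ) / c) ^ d = (1 / c) ^ d * (n : ℝ) ^ d := by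
          rw [← Real.mul_rpow (by positivity) (by positivity)]
          congr 1; ring
        have h4 := (Nat.ceil_lt_add_one (a := ((n : ℝ) / c) ^ d) (by positivity)).le
        rw [h3] at h4
        rw [h3, add_mul, one_mul]
        linarith
  -- The `+ 1` absorbs the rounding up of `N`, since `n ^ d ≥ 1` for positive `n`.
  refine ⟨(1 / c) ^ d + 1, fun n => ?_⟩
  classical
  obtain ⟨N, hN, hNle⟩ := key n
  have hex : ∃ N, RamseyProperty l n 3 N := ⟨N, hN⟩
  refine ⟨Nat.find hex, ⟨Nat.find_spec hex, fun M hM => Nat.find_min' hex hM⟩, le_trans ?_ hNle⟩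
  exact_mod_cast Nat.find_min' hex hN

end Hypergraph

theorem theorem1p4 :
    (∀ l : ℕ, 3 ≤ l → ∃ c : ℝ, ∀ n : ℕ, ∃ R : ℕ, Hypergraph.IsRamseyNumber l n 3 R ∧
      (R : ℝ) ≤ c * (n : ℝ) ^ (1 + 1 / (((l + 1) / 2 : ℕ) : ℝ))) ∧
    (∃ c : ℝ, ∀ n : ℕ, ∃ R : ℕ, Hypergraph.IsRamseyNumber 5 n 3 R ∧
      (R : ℝ) ≤ c * (n : ℝ) ^ (4 / 3 : ℝ)) ∧
    (∀ l m : ℕ, 3 ≤ l → m = (l - 1) / 2 → ∃ c : ℝ, 0 < c ∧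
      ∀ (α : Type*) (H : Hypergraph α), H.vertexSet.Finite → H.IsUniform 3 →
        ¬ H.ContainsLooseCycle l 3 →
          ∃ s : Set α, H.IsIndependent s ∧
            c * (H.vertexSet.ncard : ℝ) ^ (((m : ℝ) + 1) / ((m : ℝ) + 2)) ≤ (s.ncard : ℝ)) := by
  refine ⟨Hypergraph.exists_isRamseyNumber_le, ?_, Hypergraph.exists_isIndependent_le⟩
  obtain ⟨c, hc⟩ := Hypergraph.exists_isRamseyNumber_le 5 (by norm_num)
  have hexp : (1 + 1 / (((5 + 1) / 2 : ℕ) : ℝ)) = 4 / 3 := by norm_num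
  rw [hexp] at hc
  exact ⟨c, hc⟩
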